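/- **Proposition 4.3 (Rates of convergence in the noiseless case).** *Setting.* Let $d\ge 1$, let $|\cdot|$ be any norm on $\mathbb R^d$, let $B(x,r)$ be the closed ball of this norm, and let $v_d$ be the Lebesgue measure of $B(0,1)$. Let $\mu_X,\mu_{X'}$ be probability measures on $\mathbb R^d$ and $\mu_\Theta$ a probability measure on a measurable space $\mathbf\Theta$. Let $f:\mathbb R^d\times\mathbf\Theta\to\mathbb R^e$ be measurable and $\phi:\mathbb R^e\to\mathbb R$. Let $(X'_j,\Theta_j)_{j\ge1}$ be i.i.d. with $X'_j\sim\mu_{X'}$ and $\Theta_j\sim\mu_\Theta$ independent, put $Y'_j=f(X'_j,\Theta_j)$, and let $(X_i)_{i\ge1}$ be i.i.d. with law $\mu_X$, independent of $(X'_j,\Theta_j)_{j\ge 1}$. For $x\in\mathbb R^d$ and $1\le l\le m$, let $\mathrm{NN}^{(l)}_m(x)$ be the $l$-th closest point to $x$ among $X'_1,\dots,X'_m$ (ties in distance are broken in favour of the lowest index), and let $j^{(l)}(x)$ be the lowest index $j$ with $X'_j=\mathrm{NN}^{(l)}_m(x)$. For $1\le k\le m$ define $$\mathrm{QI}=\mathbb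 E[\phi(f(X,\Theta))],\qquad \widehat{\mathrm{QI}}{}^{(k)}_{m,n}=\frac1n\sum_{i=1}^n\frac1k\sum_{l=1}^k\phi\big(Y'_{j^{(l)}(X_i)}\big),$$ where $X\sim\mu_X$ and $\Theta\sim\mu_\Theta$ are independent. *Assumptions.* Let $q\in[2,\infty)$ and assume: 1. $f(x,\theta)$ does not depend on $\theta$, and $x\mapsto\phi(f(x,\theta))$ is globally Lipschitz continuous; 2. there is an integer $m_0\ge1$ with $\mathbb E[\min_{1\le j\le m_0}|X'_j|]<\infty$; 3. there is an open set $U\supset\mathrm{supp}(\mu_X)$ such that $\mu_{X'}(\cdot\cap U)$ has a density $p_{X'}$ with respect to Lebesgue measure which is continuous and positive on $U$, and there are $\kappa\in(0,1]$ and $r_\kappa>0$ with $\mu_{X'}(B(x,r))\ge\kappa\,p_{X'}(x)\,v_d\,r^d$ for all $x\in U$ and $r\in[0,r_\kappa]$; 4. $\mathbb E\big[(1+|X|^q)/p_{X'}(X)^{q/d}\big]<\infty$ for $X\sim\mu_X$. Let $(\tau_{1,d}(n))_{n\ge1}$ be any sequence of nonnegative numbers such that $\mathbb E\big[W_1\big(\mu_X,\frac1n\sum_{i=1}^n\delta_{X_i}\big)\big]=O(\tau_{1,d}(n))$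 as $n\to\infty$, where $W_1$ is the Wasserstein distance of order $1$. Call a sequence of positive integers $(k_m)_{m\ge1}$ admissible if it is nondecreasing and $k_m/m\to0$. *Conclusion.* $\phi(f(X,\Theta))$ is integrable, and for every admissible $(k_m)$, $$\mathbb E\Big[\big|\mathrm{QI}-\widehat{\mathrm{QI}}{}^{(k_m)}_{m,n}\big|^q\Big]^{1/q}=O\Big(\frac1{\sqrt n}+\tau_{1,d}(n)\Big)+O\Big(\Big(\frac{k_m}{m}\Big)^{1/d}\Big),$$ that is, there are $C$ and $M$ such that for all $m\ge M$ and all $n\ge1$ the left-hand side is finite and at most $C\big(n^{-1/2}+\tau_{1,d}(n)\big)+C(k_m/m)^{1/d}$. Moreover the constant sequence $k_m=1$ is admissible and optimal for this rate: $(1/m)^{1/d}\le(k_m/m)^{1/d}$ for every admissible $(k_m)$ and every $m\ge1$. -/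

import Mathlib

open MeasureTheory ProbabilityTheory Filter Topology
open scoped ENNReal NNReal

namespace CovariateShift

noncomputable section

/-! ### Wasserstein distance and empirical measures -/

/-- The couplings of `μ` and `ν`: measures on `E × E` with marginals `μ` and `ν`. -/
def couplings {E : Type*} [MeasurableSpace E] (μ ν : Measure E) : Set (Measure (E × E)) :=
  {γ | γ.map Prod.fst = μ ∧ γ.map Prod.snd = ν}

/-- The Wasserstein distance of order `q`, as an extended nonnegative number. -/
def wasserstein {E : Type*} [NormedAddCommGroup E] [MeasurableSpace E] (q : ℝ)
    (μ ν : Measure E) : ℝ≥0∞ :=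
  (⨅ γ ∈ couplings μ ν, ∫⁻ z, ENNReal.ofReal (‖z.1 - z.2‖ ^ q) ∂γ) ^ (1 / q)

/-- The empirical measure `(1/n) ∑ δ_{x_i}` of a finite sample. -/
def empiricalMeasure {E : Type*} [MeasurableSpace E] {n : ℕ} (x : Fin n → E) : Measure E :=
  (n : ℝ≥0∞)⁻¹ • ∑ i, Measure.dirac (x i)

/-! ### Nearest neighbours and the estimator -/

/-- The nearest neighbours of `x` in the sample `x'`: the sample points are ranked by increasing
distance to `x`, ties being broken in favour of the lowest index (`Tuple.sort` is the stable sort).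
Ranks start at `0`, so the `l`-th nearest neighbour of the literature has rank `l - 1`. -/
def nearestNeighbor {E : Type*} [NormedAddCommGroup E] {m : ℕ} (x' : Fin m → E) (l : Fin m)
    (x : E) : E :=
  x' (Tuple.sort (fun j => ‖x - x' j‖) l)

open Classical in
/-- The lowest index `j` such that `x' j` is the nearest neighbour of `x` of rank `l`. -/
def nearestNeighborIndex {E : Type*} [NormedAddCommGroup E] {m : ℕ} (x' : Fin m → E) (l : Fin m)
    (x : E) : Fin m :=
  (Finset.univ.filter fun j => x' j = nearestNeighbor x' l x).min'
    ⟨Tuple.sort (fun j => ‖x - x' j‖) l,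
      Finset.mem_filter.2 ⟨Finset.mem_univ _, rfl⟩⟩

/-- The `k`-nearest-neighbour regression estimate at `x`, for `1 ≤ k ≤ m`, from the observations
`(x' j, z j)`: the average of `z` over the indices of the first `k` nearest neighbours of `x`. -/
def knnRegression {E : Type*} [NormedAddCommGroup E] {m : ℕ} (k : ℕ) (x' : Fin m → E)
    (z : Fin m → ℝ) (x : E) : ℝ :=
  (1 / (k : ℝ)) * ∑ l with (l : Fin m).val < k, z (nearestNeighborIndex x' l x)

/-- The estimator of the quantity of interest: the average of the `k`-nearest-neighbour regression
estimate over the evaluation sample `x`. The values of `φ(Y'_j)` are given by `z`. -/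
def qiEstimator {E : Type*} [NormedAddCommGroup E] {m n : ℕ} (k : ℕ) (x' : Fin m → E)
    (z : Fin m → ℝ) (x : Fin n → E) : ℝ :=
  (1 / (n : ℝ)) * ∑ i, knnRegression k x' z (x i)

/-- The quantity of interest `E[φ(f(X, Θ))]` for independent `X ∼ μX` and `Θ ∼ μΘ`. -/
def quantityOfInterest {E T F : Type*} [MeasurableSpace E] [MeasurableSpace T]
    (μX : Measure E) (μΘ : Measure T) (f : E × T → F) (φ : F → ℝ) : ℝ :=
  ∫ z, φ (f z) ∂(μX.prod μΘ)

/-! ### Sampling and assumptions -/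

/-- Regression under covariate shift: the training variables `(X'_j, Θ_j)` are i.i.d. with
`X'_j ∼ μX'` and `Θ_j ∼ μΘ` independent, the evaluation variables `X_i` are i.i.d. with law `μX`,
and the evaluation sequence is independent of the training sequence. -/
structure IsCovariateShiftSample {Ω E T : Type*} [MeasurableSpace Ω] [MeasurableSpace E]
    [MeasurableSpace T] (P : Measure Ω) (μX μX' : Measure E) (μΘ : Measure T)
    (X' : ℕ → Ω → E) (Θ : ℕ → Ω → T) (X : ℕ → Ω → E) : Prop where
  measurable_train : ∀ j, Measurable (X' j)
  measurable_noise : ∀ j, Measurable (Θ j)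
  measurable_eval : ∀ i, Measurable (X i)
  law_train : ∀ j, P.map (X' j) = μX'
  law_noise : ∀ j, P.map (Θ j) = μΘ
  law_eval : ∀ i, P.map (X i) = μX
  indep_noise : ∀ j, IndepFun (X' j) (Θ j) P
  indep_train : iIndepFun (fun j ω => (X' j ω, Θ j ω)) P
  indep_eval : iIndepFun X P
  indep_train_eval : IndepFun (fun ω j => (X' j ω, Θ j ω)) (fun ω i => X i ω) P

/-- Min-integrability: the minimum of the norms of the first `m₀` training points is integrable,
for some `m₀ ≥ 1`. -/
def MinIntegrable {Ω E : Type*} [MeasurableSpace Ω] [NormedAddCommGroup E]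
    (P : Measure Ω) (X' : ℕ → Ω → E) : Prop :=
  ∃ m₀ : ℕ, 1 ≤ m₀ ∧ Integrable (fun ω => ⨅ j : Fin m₀, ‖X' j ω‖) P

/-- The strong support condition with open set `U` and density `p` (only the values of `p` on `U`
matter); `lam` is Lebesgue measure, and `lam.real (closedBall 0 1)` is the volume of the unit
ball, and `d` is the dimension. -/
structure StrongSupport {E : Type*} [NormedAddCommGroup E] [MeasurableSpace E]
    (d : ℕ) (lam μX μX' : Measure E) (U : Set E) (p : E → ℝ) : Prop where
  isOpen : IsOpen U
  support_subset : μX.support ⊆ U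
  density : μX'.restrict U = (lam.restrict U).withDensity fun x => ENNReal.ofReal (p x)
  continuousOn : ContinuousOn p U
  pos : ∀ x ∈ U, 0 < p x
  minimal_mass : ∃ κ r₀ : ℝ, 0 < κ ∧ κ ≤ 1 ∧ 0 < r₀ ∧ ∀ x ∈ U, ∀ r : ℝ, 0 ≤ r → r ≤ r₀ →
    κ * p x * lam.real (Metric.closedBall (0 : E) 1) * r ^ d ≤
      μX'.real (Metric.closedBall x r)

/-- The moment condition `E[(1 + |X|^q) / p(X)^(q/d)] < ∞`. -/
def MomentCondition {E : Type*} [NormedAddCommGroup E] [MeasurableSpace E]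
    (d : ℕ) (q : ℝ) (μX : Measure E) (p : E → ℝ) : Prop :=
  Integrable (fun x => (1 + ‖x‖ ^ q) / p x ^ (q / d)) μX

/-- The sequences `(k_m)_{m ≥ 1}` of numbers of neighbours that are allowed: positive integers,
nondecreasing, with `k_m / m → 0`. The value at `0` is irrelevant. -/
structure IsNeighborSequence (k : ℕ → ℕ) : Prop where
  pos : ∀ m, 1 ≤ m → 1 ≤ k m
  mono : MonotoneOn k (Set.Ici 1)
  tendsto : Tendsto (fun m : ℕ => (k m : ℝ) / m) atTop (𝓝 0)

/-- `τ` is a rate for the empirical measures of the sequence `X` in `W_q` distance: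
`E[W_q^q(μX, (1/n) ∑_{i ≤ n} δ_{X_i})] = O(τ n)` as `n → ∞`. -/
def IsEmpiricalRate {Ω E : Type*} [MeasurableSpace Ω] [NormedAddCommGroup E] [MeasurableSpace E]
    (P : Measure Ω) (q : ℝ) (μX : Measure E) (X : ℕ → Ω → E) (τ : ℕ → ℝ≥0) : Prop :=
  ∃ C : ℝ≥0, ∀ᶠ n : ℕ in atTop,
    ∫⁻ ω, wasserstein q μX (empiricalMeasure fun i : Fin n => X i ω) ^ q ∂P ≤ C * τ n

end

end CovariateShift

namespace CovariateShift

/-! Without noise the estimator only averages values of the Lipschitz function `g x = φ (f (x, θ₀))`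
at sample points. Replacing `g (X i)` by the average of `g` over its `k` nearest neighbours costs at
most the Lipschitz constant times the distance to the `k`-th neighbour. The error thus splits into a
Monte Carlo error for `g` and the mean over `i` of these distances, and both are bounded in `L^q`.

Monte Carlo error: `exists_integral_abs_sum_rpow_le` bounds the `q`-th moment of a sum of `n` i.i.d.
centred variables by a multiple of `n ^ (q / 2)`, by induction on `n`. The integrability it needs
holds because the mass condition bounds `p` on `U`, so the moment condition controls `E[‖X‖ ^ q]`.

Distances: the neighbour of rank `l` is farther than `r` from `x` only if at most `l` training
points lie in the closed ball of radius `r`, which a Chernoff bound makes unlikely. For small `r`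
the ball has mass at least `c * p x * r ^ d`, giving the scale `(k / (m * c * p x)) ^ (1 / d)` with
tails of any polynomial order. For large `r`, integrability of the minimum of `m₀` norms gives tails
of any prescribed polynomial order at a scale of size `‖x‖ + 1`, once `m` is large.
`exists_lintegral_norm_sub_nearestNeighbor_rpow_le` combines the two regimes into a bound of the
moment by `(k / m) ^ (q / d) * (1 + ‖x‖ ^ q) / p x ^ (q / d)`. By independence this is integrated
against the law of `X`, and the moment condition makes the result finite. -/

/-! ### Moments from tails, and moments of sums of independent variables. -/

/-- A polynomial tail bound of order `S > q` bounds the moment of order `q`. -/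
theorem lintegral_rpow_le_of_tail_le {Ω : Type*} [MeasurableSpace Ω] (P : Measure Ω)
    [IsFiniteMeasure P] {Z : Ω → ℝ} (hZ : Measurable Z) (hZ0 : ∀ ω, 0 ≤ Z ω) {q S A R : ℝ}
    (hq : 0 < q) (hS : q < S) (hA : 0 ≤ A) (hR : 0 < R)
    (h1 : ∀ r, 0 < r → P.real {ω | r < Z ω} ≤ A)
    (h2 : ∀ r, 0 < r → P.real {ω | r < Z ω} ≤ A * (R / r) ^ S) :
    ∫⁻ ω, ENNReal.ofReal (Z ω ^ q) ∂P ≤ ENNReal.ofReal (A * (1 + q / (S - q)) * R ^ q) := by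
  rw [lintegral_rpow_eq_lintegral_meas_lt_mul P (ae_of_all _ hZ0) hZ.aemeasurable hq]
  -- In the layer-cake formula the bound `A` is used below `R` and the power tail above `R`; the two
  -- agree at `R`.
  have hsub : (Set.Ioi (0 : ℝ)) ⊆ Set.Ioc 0 R ∪ Set.Ioi R := by
    intro t ht
    rcases le_or_gt t R with h | h
    · exact Or.inl ⟨ht, h⟩
    · exact Or.inr h
  have hconv : ∀ t, P {ω | t < Z ω} = ENNReal.ofReal (P.real {ω | t < Z ω}) := by
    intro t; rw [ofReal_measureReal]
  have e1 : ∫⁻ t in Set.Ioc 0 R, P {ω | t < Z ω} * ENNReal.ofReal (t ^ (q - 1)) ≤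
      ENNReal.ofReal (A * (R ^ q / q)) := by
    have hi : IntegrableOn (fun t : ℝ => A * t ^ (q - 1)) (Set.Ioc 0 R) := by
      have := (intervalIntegral.intervalIntegrable_rpow' (a := 0) (b := R)
        (show -1 < q - 1 by linarith)).const_mul A
      rwa [intervalIntegrable_iff_integrableOn_Ioc_of_le hR.le] at this
    have hv : ∫ t in Set.Ioc 0 R, A * t ^ (q - 1) = A * (R ^ q / q) := by
      rw [integral_const_mul, ← intervalIntegral.integral_of_le hR.le,
        integral_rpow (Or.inl (by linarith))]
      simp [hq.ne']
    rw [← hv, ofReal_integral_eq_lintegral_ofReal hi]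
    · refine setLIntegral_mono' measurableSet_Ioc fun t ht => ?_
      rw [hconv, ← ENNReal.ofReal_mul measureReal_nonneg]
      exact ENNReal.ofReal_le_ofReal
        (mul_le_mul_of_nonneg_right (h1 t ht.1) (Real.rpow_nonneg ht.1.le _))
    · exact (ae_restrict_mem measurableSet_Ioc).mono fun t ht =>
        mul_nonneg hA (Real.rpow_nonneg ht.1.le _)
  have e2 : ∫⁻ t in Set.Ioi R, P {ω | t < Z ω} * ENNReal.ofReal (t ^ (q - 1)) ≤
      ENNReal.ofReal (A * (R ^ q / (S - q))) := by
    have hi : IntegrableOn (fun t : ℝ => A * R ^ S * t ^ (q - 1 - S)) (Set.Ioi R) :=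
      (integrableOn_Ioi_rpow_of_lt (by linarith) hR).const_mul _
    have hv : ∫ t in Set.Ioi R, A * R ^ S * t ^ (q - 1 - S) = A * (R ^ q / (S - q)) := by
      rw [integral_const_mul, integral_Ioi_rpow_of_lt (by linarith) hR]
      have : R ^ q = R ^ S * R ^ (q - 1 - S + 1) := by
        rw [← Real.rpow_add hR]; congr 1; ring
      rw [this]
      have h3 : q - 1 - S + 1 = -(S - q) := by ring
      have h4 : S - q ≠ 0 := by linarith
      rw [h3]
      field_simp
    rw [← hv, ofReal_integral_eq_lintegral_ofReal hi]
    · refine setLIntegral_mono' measurableSet_Ioi fun t ht => ?_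
      have ht0 : 0 < t := hR.trans ht
      rw [hconv, ← ENNReal.ofReal_mul measureReal_nonneg]
      refine ENNReal.ofReal_le_ofReal
        ((mul_le_mul_of_nonneg_right (h2 t ht0) (Real.rpow_nonneg ht0.le _)).trans_eq ?_)
      rw [Real.div_rpow hR.le ht0.le, Real.rpow_sub ht0 (q - 1) S]
      ring
    · exact (ae_restrict_mem measurableSet_Ioi).mono fun t ht =>
        mul_nonneg (mul_nonneg hA (Real.rpow_nonneg hR.le _))
          (Real.rpow_nonneg (hR.trans ht).le _)
  have hSq : 0 < S - q := by linarith
  calc _ ≤ ENNReal.ofReal q * (ENNReal.ofReal (A * (R ^ q / q)) +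
        ENNReal.ofReal (A * (R ^ q / (S - q)))) := by
        gcongr
        exact (lintegral_mono_set hsub).trans ((lintegral_union_le _ _ _).trans (add_le_add e1 e2))
    _ = _ := by
        rw [← ENNReal.ofReal_add (by positivity) (by positivity), ← ENNReal.ofReal_mul hq.le]
        congr 1
        field_simp

/-- A second-order expansion of `t ↦ |1 + t| ^ q` with a remainder valid for all `t`. -/
theorem abs_one_add_rpow_le {q : ℝ} (hq : 2 ≤ q) (t : ℝ) :
    |1 + t| ^ q ≤ 1 + q * t +
      ((4 * q + 1) ^ q + q * (4 * q) ^ q + 8 * q ^ 2) * (t ^ 2 + |t| ^ q) := by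
  have hq0 : 0 < q := by linarith
  have hT : 0 ≤ |t| ^ q := Real.rpow_nonneg (abs_nonneg _) _
  have hK1 : 0 ≤ (4 * q + 1) ^ q := by positivity
  have hK2 : 0 ≤ q * (4 * q) ^ q := by positivity
  -- For `|t| ≥ 1 / (4 q)` the term `|t| ^ q` alone dominates, up to constants.
  rcases le_or_gt 1 (4 * q * |t|) with h | h
  · have b1 : |1 + t| ^ q ≤ (4 * q + 1) ^ q * |t| ^ q := by
      rw [← Real.mul_rpow (by positivity) (abs_nonneg _)]
      refine Real.rpow_le_rpow (abs_nonneg _) ?_ hq0.le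
      calc |1 + t| ≤ |1| + |t| := abs_add_le _ _
        _ ≤ _ := by rw [abs_one]; linarith
    have b2 : |t| ≤ (4 * q) ^ q * |t| ^ q := by
      rw [← Real.mul_rpow (by positivity) (abs_nonneg _)]
      have : (4 * q * |t|) ^ (1 : ℝ) ≤ (4 * q * |t|) ^ q :=
        Real.rpow_le_rpow_of_exponent_le h (by linarith)
      rw [Real.rpow_one] at this
      nlinarith [abs_nonneg t]
    have b3 : -(q * t) ≤ q * (4 * q) ^ q * |t| ^ q := by
      have := mul_le_mul_of_nonneg_left b2 hq0.le
      nlinarith [neg_abs_le t]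
    nlinarith [mul_nonneg hK1 (sq_nonneg t), mul_nonneg hK2 (sq_nonneg t), sq_nonneg (q * t),
      mul_nonneg (sq_nonneg q) hT]
  · have ht : |t| < 1 / 8 := by nlinarith [abs_nonneg t]
    obtain ⟨ht1, ht2⟩ := abs_lt.1 ht
    have hpos : 0 < 1 + t := by linarith
    -- Bernoulli's inequality bounds powers from below. Applied to `1 - s = (1 + t)⁻¹` and inverted,
    -- it gives an upper bound on `(1 + t) ^ q` without Taylor's formula. With `y = q * s ≤ 1 / 2`,
    -- the inverse of `1 - y` is at most `1 + y + 2 * y ^ 2`.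
    set s := t / (1 + t) with hs
    have hst : s * (1 + t) = t := by rw [hs]; field_simp
    have hs1 : 1 - s = (1 + t)⁻¹ := by rw [hs]; field_simp; ring
    have hsle : s ≤ t := by
      rw [hs, div_le_iff₀ hpos]; nlinarith [sq_nonneg t]
    have hsabs : |s| ≤ 2 * |t| := by
      rw [hs, abs_div, abs_of_pos hpos, div_le_iff₀ hpos]
      nlinarith [abs_nonneg t]
    have hs2 : s ^ 2 ≤ 4 * t ^ 2 := by
      have := mul_self_le_mul_self (abs_nonneg s) hsabs
      nlinarith [abs_mul_abs_self s, abs_mul_abs_self t]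
    have hqs : q * s ≤ 1 / 2 := by
      have : q * s ≤ q * |s| := mul_le_mul_of_nonneg_left (le_abs_self s) hq0.le
      nlinarith
    have hB : 1 + q * (-s) ≤ (1 + -s) ^ q :=
      one_add_mul_self_le_rpow_one_add (by linarith) (by linarith)
    have hpow : (1 + -s) ^ q = ((1 + t) ^ q)⁻¹ := by
      rw [← sub_eq_add_neg, hs1, Real.inv_rpow hpos.le]
    rw [hpow] at hB
    have hX : 0 < (1 + t) ^ q := Real.rpow_pos_of_pos hpos _
    have h1 : (1 + q * (-s)) * (1 + t) ^ q ≤ 1 := by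
      have := mul_le_mul_of_nonneg_right hB hX.le
      rwa [inv_mul_cancel₀ hX.ne'] at this
    have h2 : (1 + t) ^ q ≤ 1 + q * s + 2 * (q * s) ^ 2 := by
      set y := q * s
      have hy : 0 < 1 - y := by linarith
      have h3 : (1 - y) * (1 + t) ^ q ≤ (1 - y) * (1 + y + 2 * y ^ 2) := by
        have : (1 + q * (-s)) = 1 - y := by simp only [y]; ring
        rw [this] at h1
        nlinarith [mul_nonneg (sq_nonneg y) (show 0 ≤ 1 - 2 * y by linarith)]
      exact le_of_mul_le_mul_left h3 hy
    rw [abs_of_pos hpos]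
    have h4 : q * s ≤ q * t := mul_le_mul_of_nonneg_left hsle hq0.le
    have h5 : (q * s) ^ 2 ≤ q ^ 2 * (4 * t ^ 2) := by
      rw [mul_pow]; exact mul_le_mul_of_nonneg_left hs2 (sq_nonneg q)
    have hK : 0 ≤ (4 * q + 1) ^ q + q * (4 * q) ^ q := add_nonneg hK1 hK2
    nlinarith [mul_nonneg hK (add_nonneg (sq_nonneg t) hT), mul_nonneg (sq_nonneg q) hT]

/-- The homogeneous form of the previous expansion, with `t = b / a`. The first-order term is kept
exact because its expectation vanishes when `b` is centred and independent of `a`. -/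
theorem exists_abs_add_rpow_le {q : ℝ} (hq : 2 ≤ q) : ∃ C : ℝ, 0 ≤ C ∧ ∀ a b : ℝ,
    |a + b| ^ q ≤ |a| ^ q + q * (|a| ^ (q - 2) * a * b) +
      C * (|a| ^ (q - 2) * b ^ 2 + |b| ^ q) := by
  have hq0 : 0 < q := by linarith
  refine ⟨(4 * q + 1) ^ q + q * (4 * q) ^ q + 8 * q ^ 2, by positivity, fun a b => ?_⟩
  set C := (4 * q + 1) ^ q + q * (4 * q) ^ q + 8 * q ^ 2
  rcases eq_or_ne a 0 with rfl | ha
  · have hC : 1 ≤ C := by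
      have h1 : 0 ≤ (4 * q + 1) ^ q := by positivity
      have h2 : 0 ≤ q * (4 * q) ^ q := by positivity
      simp only [C]; nlinarith
    have h1 : 0 ≤ |b| ^ q := by positivity
    have h2 : 0 ≤ |(0 : ℝ)| ^ (q - 2) * b ^ 2 := by positivity
    rw [zero_add, abs_zero, Real.zero_rpow hq0.ne'] at *
    nlinarith
  · have h := abs_one_add_rpow_le hq (b / a)
    have ha' : 0 < |a| := abs_pos.2 ha
    have e0 : |a| ^ q = |a| ^ (q - 2) * a ^ 2 := by
      rw [← sq_abs a, ← Real.rpow_natCast |a| 2, ← Real.rpow_add ha']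
      congr 1; norm_num
    have e1 : |a + b| ^ q = |a| ^ q * |1 + b / a| ^ q := by
      rw [← Real.mul_rpow ha'.le (abs_nonneg _), ← abs_mul]
      congr 2; field_simp
    have e2 : |a| ^ q * |b / a| ^ q = |b| ^ q := by
      rw [← Real.mul_rpow ha'.le (abs_nonneg _), ← abs_mul]
      congr 2; field_simp
    have e3 : |a| ^ q * (b / a) ^ 2 = |a| ^ (q - 2) * b ^ 2 := by
      rw [e0]; field_simp
    have e4 : |a| ^ q * (b / a) = |a| ^ (q - 2) * a * b := by
      rw [e0]; field_simp
    rw [e1, ← e2, ← e3, ← e4]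
    have := mul_le_mul_of_nonneg_left h (Real.rpow_nonneg ha'.le q)
    linarith [this]

/-- Jensen's inequality for the concave power `r / q`; integrability comes from `|Y| ^ r ≤ 1 + |Y| ^
q`. -/
theorem integral_abs_rpow_le_rpow_integral {Ω : Type*} [MeasurableSpace Ω] (P : Measure Ω)
    [IsProbabilityMeasure P] {Y : Ω → ℝ} {q r : ℝ} (hr : 0 ≤ r) (hrq : r ≤ q) (hq : 0 < q)
    (hY : MemLp Y (ENNReal.ofReal q) P) :
    Integrable (fun ω => |Y ω| ^ r) P ∧
      ∫ ω, |Y ω| ^ r ∂P ≤ (∫ ω, |Y ω| ^ q ∂P) ^ (r / q) := by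
  have hiq : Integrable (fun ω => |Y ω| ^ q) P := by
    have := hY.integrable_norm_rpow (by simpa using hq) ENNReal.ofReal_ne_top
    simpa [ENNReal.toReal_ofReal hq.le] using this
  have e : ∀ ω, (|Y ω| ^ q) ^ (r / q) = |Y ω| ^ r := by
    intro ω
    rw [← Real.rpow_mul (abs_nonneg _)]; congr 1; field_simp
  have hir : Integrable (fun ω => |Y ω| ^ r) P := by
    refine ((integrable_const 1).add hiq).mono' ?_ (ae_of_all _ fun ω => ?_)
    · simpa [Function.comp_def, ← Real.norm_eq_abs] using
        (hY.1.norm.aemeasurable.pow_const r).aestronglyMeasurable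
    · rw [Real.norm_of_nonneg (by positivity)]
      simp only [Pi.add_apply]
      rcases le_total |Y ω| 1 with h | h
      · have := Real.rpow_le_one (abs_nonneg _) h hr
        have : 0 ≤ |Y ω| ^ q := by positivity
        linarith
      · have := Real.rpow_le_rpow_of_exponent_le h hrq
        linarith
  refine ⟨hir, ?_⟩
  have hj := ConcaveOn.le_map_integral (μ := P) (f := fun ω => |Y ω| ^ q)
    (Real.concaveOn_rpow (p := r / q) (by positivity) ((div_le_one hq).2 hrq))
    (fun x _ => (Real.continuousAt_rpow_const x _ (Or.inr (by positivity))).continuousWithinAt) isClosed_Ici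
    (ae_of_all _ fun ω => Set.mem_Ici.2 (by positivity)) hiq
    (by simpa only [Function.comp_def, e] using hir)
  simpa only [e] using hj

/-- The moment of order `q ≥ 2` of a sum of `n` independent centred variables is of order
`n ^ (q / 2)`. -/
theorem exists_integral_abs_sum_rpow_le {Ω : Type*} [MeasurableSpace Ω] (P : Measure Ω)
    [IsProbabilityMeasure P] {q : ℝ} (hq : 2 ≤ q) {Y : ℕ → Ω → ℝ} (hind : iIndepFun Y P)
    (hmeas : ∀ i, Measurable (Y i)) (hLq : ∀ i, MemLp (Y i) (ENNReal.ofReal q) P)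
    (hmean : ∀ i, ∫ ω, Y i ω ∂P = 0) {M : ℝ} (hM : ∀ i, ∫ ω, |Y i ω| ^ q ∂P ≤ M) :
    ∃ A : ℝ, 0 ≤ A ∧ ∀ n : ℕ, 1 ≤ n →
      ∫ ω, |∑ i ∈ Finset.range n, Y i ω| ^ q ∂P ≤ (A * n) ^ (q / 2) := by
  have hq0 : 0 < q := by linarith
  obtain ⟨C, hC, hCab⟩ := exists_abs_add_rpow_le hq
  set M₁ := max M 1 with hM₁
  have hM1 : 1 ≤ M₁ := le_max_right _ _
  have hYq : ∀ i, ∫ ω, |Y i ω| ^ q ∂P ≤ M₁ := fun i => (hM i).trans (le_max_left _ _)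
  have hY2 : ∀ i, Integrable (fun ω => |Y i ω| ^ (2 : ℝ)) P ∧
      ∫ ω, |Y i ω| ^ (2 : ℝ) ∂P ≤ M₁ := by
    intro i
    obtain ⟨h1, h2⟩ := integral_abs_rpow_le_rpow_integral P (by norm_num) hq hq0 (hLq i)
    refine ⟨h1, h2.trans ?_⟩
    have h3 : 0 ≤ ∫ ω, |Y i ω| ^ q ∂P := integral_nonneg fun ω => by positivity
    calc _ ≤ M₁ ^ (2 / q) := Real.rpow_le_rpow h3 (hYq i) (by positivity)
      _ ≤ M₁ ^ (1 : ℝ) := Real.rpow_le_rpow_of_exponent_le hM1 ((div_le_one hq0).2 hq)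
      _ = M₁ := Real.rpow_one _
  -- The first summand absorbs the two remainder terms of the induction step, using `q / 2 ≥ 1`. The
  -- second gives `1 ≤ M₁ ≤ A`, which the base case needs.
  set A := 2 * C * M₁ + M₁ with hA
  have hA1 : 1 ≤ A := by nlinarith [mul_nonneg hC (zero_le_one.trans hM1)]
  refine ⟨A, by linarith, fun n hn => ?_⟩
  set S : ℕ → Ω → ℝ := fun n ω => ∑ i ∈ Finset.range n, Y i ω with hS
  have hSLq : ∀ n, MemLp (S n) (ENNReal.ofReal q) P := fun n =>
    memLp_finsetSum _ fun i _ => hLq i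
  have hSm : ∀ n, Measurable (S n) := fun n => Finset.measurable_fun_sum _ fun i _ => hmeas i
  have habs : ∀ {Z : Ω → ℝ}, MemLp Z (ENNReal.ofReal q) P →
      Integrable (fun ω => |Z ω| ^ q) P := fun h =>
    (integral_abs_rpow_le_rpow_integral P hq0.le le_rfl hq0 h).1
  induction n, hn using Nat.le_induction with
  | base =>
    have e : ∀ ω, ∑ i ∈ Finset.range 1, Y i ω = Y 0 ω := by intro ω; simp
    simp only [e]
    refine (hYq 0).trans ?_
    calc M₁ ≤ A := by nlinarith [mul_nonneg hC (zero_le_one.trans hM1)]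
      _ = A ^ (1 : ℝ) := (Real.rpow_one _).symm
      _ ≤ A ^ (q / 2) := Real.rpow_le_rpow_of_exponent_le hA1 (by linarith)
      _ = _ := by simp
  | succ n hn ih =>
    have hn' : (1 : ℝ) ≤ n := by exact_mod_cast hn
    have hindS : IndepFun (S n) (Y n) P := by
      have := hind.indepFun_finsetSum_of_notMem hmeas (s := Finset.range n) (i := n) (by simp)
      convert this using 1
      ext ω; simp [hS]
    have hmr : ∀ r : ℝ, Measurable fun x : ℝ => |x| ^ r := fun r =>
      (measurable_norm (α := ℝ)).pow_const r
    obtain ⟨i1, b1⟩ := integral_abs_rpow_le_rpow_integral P (r := q - 2) (by linarith)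
      (by linarith) hq0 (hSLq n)
    have i2 : Integrable (fun ω => |S n ω| ^ (q - 2) * S n ω) P := by
      refine (integral_abs_rpow_le_rpow_integral P (r := q - 1) (by linarith)
        (by linarith) hq0 (hSLq n)).1.mono' ?_ (ae_of_all _ fun ω => ?_)
      · exact (((hmr _).comp (hSm n)).mul (hSm n)).aestronglyMeasurable
      · rw [norm_mul, Real.norm_of_nonneg (by positivity), Real.norm_eq_abs]
        rcases eq_or_ne (S n ω) 0 with h | h
        · rw [h]; simp; positivity
        · rw [← Real.rpow_add_one (abs_pos.2 h).ne']
          apply le_of_eq; congr 1; ring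
    have hY1 : Integrable (Y n) P := (hLq n).integrable (by
      rw [ENNReal.one_le_ofReal]; linarith)
    have hi_lin : IndepFun (fun ω => |S n ω| ^ (q - 2) * S n ω) (Y n) P :=
      hindS.comp ((hmr (q - 2)).mul measurable_id) measurable_id
    have hi_sq : IndepFun (fun ω => |S n ω| ^ (q - 2)) (fun ω => |Y n ω| ^ (2 : ℝ)) P :=
      hindS.comp (hmr (q - 2)) (hmr 2)
    have j1 := hi_lin.integrable_mul i2 hY1
    have j2 := hi_sq.integrable_mul i1 (hY2 n).1
    have v1 := hi_lin.integral_mul_eq_mul_integral i2.1 hY1.1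
    have v2 := hi_sq.integral_mul_eq_mul_integral i1.1 (hY2 n).1.1
    rw [hmean, mul_zero] at v1
    have hstep : ∫ ω, |S (n + 1) ω| ^ q ∂P ≤ ∫ ω, |S n ω| ^ q ∂P +
        C * ((∫ ω, |S n ω| ^ (q - 2) ∂P) * ∫ ω, |Y n ω| ^ (2 : ℝ) ∂P +
          ∫ ω, |Y n ω| ^ q ∂P) := by
      calc _ ≤ ∫ ω, (|S n ω| ^ q + q * ((fun ω => |S n ω| ^ (q - 2) * S n ω) * Y n) ω +
            C * (((fun ω => |S n ω| ^ (q - 2)) * (fun ω => |Y n ω| ^ (2 : ℝ))) ω +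
              |Y n ω| ^ q)) ∂P := by
            refine integral_mono (habs (hSLq _)) (((habs (hSLq n)).add (j1.const_mul q)).add
              ((j2.add (habs (hLq n))).const_mul C)) fun ω => ?_
            have := hCab (S n ω) (Y n ω)
            simp only [Pi.mul_apply, Real.rpow_two, sq_abs]
            simpa only [hS, Finset.sum_range_succ] using this
        _ = _ := by
            have k1 : Integrable (fun ω => |S n ω| ^ q +
                q * ((fun ω => |S n ω| ^ (q - 2) * S n ω) * Y n) ω) P :=
              (habs (hSLq n)).add (j1.const_mul q)
            have k2 : Integrable (fun ω => C * (((fun ω => |S n ω| ^ (q - 2)) *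
                (fun ω => |Y n ω| ^ (2 : ℝ))) ω + |Y n ω| ^ q)) P :=
              (j2.add (habs (hLq n))).const_mul C
            rw [integral_add k1 k2, integral_add (habs (hSLq n))
              (j1.const_mul q), integral_const_mul, integral_const_mul,
              integral_add j2 (habs (hLq n)), v1, v2]
            ring
    have hAn : 1 ≤ A * n := by nlinarith
    have hAn0 : 0 < A * n := by linarith
    have hb : ∫ ω, |S n ω| ^ (q - 2) ∂P ≤ (A * n) ^ (q / 2 - 1) := by
      refine b1.trans ((Real.rpow_le_rpow (integral_nonneg fun ω => by positivity) ih
        (div_nonneg (by linarith) hq0.le)).trans_eq ?_)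
      rw [← Real.rpow_mul hAn0.le]
      congr 1; field_simp
    have hone : 1 ≤ (A * n) ^ (q / 2 - 1) := Real.one_le_rpow hAn (by linarith)
    -- Bernoulli with exponent `q / 2`: the claimed bound grows from `n` to `n + 1` by at least the
    -- order of the second-order term.
    have hmono : (A * n) ^ (q / 2) + q / 2 * A * (A * n) ^ (q / 2 - 1) ≤
        (A * (n + 1 : ℕ)) ^ (q / 2) := by
      have e1 : A * ((n + 1 : ℕ) : ℝ) = A * n * (1 + 1 / n) := by
        push_cast; field_simp
      have hB := one_add_mul_self_le_rpow_one_add (s := 1 / (n : ℝ)) (p := q / 2)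
        ((by norm_num : (-1 : ℝ) ≤ 0).trans (by positivity)) (by linarith)
      rw [e1, Real.mul_rpow hAn0.le (by positivity)]
      refine le_trans (le_of_eq ?_) (mul_le_mul_of_nonneg_left hB (by positivity))
      have e2 : (A * n) ^ (q / 2) = (A * n) ^ (q / 2 - 1) * (A * n) := by
        rw [← Real.rpow_add_one hAn0.ne']; congr 1; ring
      rw [e2]; field_simp
    set B := (A * n) ^ (q / 2 - 1)
    have h2 : (∫ ω, |S n ω| ^ (q - 2) ∂P) * ∫ ω, |Y n ω| ^ (2 : ℝ) ∂P ≤ B * M₁ :=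
      mul_le_mul hb (hY2 n).2 (integral_nonneg fun ω => by positivity) (by positivity)
    have h3 : ∫ ω, |Y n ω| ^ q ∂P ≤ B * M₁ := (hYq n).trans (by nlinarith)
    have h4 := mul_le_mul_of_nonneg_left (add_le_add h2 h3) hC
    have h5 : C * (B * M₁ + B * M₁) ≤ q / 2 * A * B := by
      have : 2 * C * M₁ ≤ q / 2 * A := by nlinarith
      nlinarith
    linarith [ih, hstep, hmono]

/-! ### Nearest neighbours -/

theorem apply_nearestNeighborIndex {E : Type*} [NormedAddCommGroup E] {m : ℕ} (x' : Fin m → E)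
    (l : Fin m) (x : E) : x' (nearestNeighborIndex x' l x) = nearestNeighbor x' l x := by
  classical
  unfold nearestNeighborIndex
  generalize_proofs h
  exact (Finset.mem_filter.1 (Finset.min'_mem
    (Finset.univ.filter fun j => x' j = nearestNeighbor x' l x) h)).2

/-- In sorted order, the points within `r` of `x` occupy an initial segment of ranks that misses
`l`. Ranks start at `0`, so there are at most `l` of them. -/
theorem card_le_of_lt_norm_sub_nearestNeighbor {E : Type*} [NormedAddCommGroup E] {m : ℕ}
    {x' : Fin m → E} {l : Fin m} {x : E} {r : ℝ} (h : r < ‖x - nearestNeighbor x' l x‖) :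
    (Finset.univ.filter fun j => ‖x - x' j‖ ≤ r).card ≤ l := by
  have hm := Tuple.monotone_sort (fun j => ‖x - x' j‖)
  have := (Tuple.lt_card_le_iff_apply_le_of_monotone (j := l) (a := r) hm).not.2
    (not_le.2 h)
  rw [not_lt] at this
  refine le_trans (le_of_eq ?_) this
  refine (Finset.card_bij (fun i _ => Tuple.sort (fun j => ‖x - x' j‖) i) ?_ ?_ ?_).symm
  · intro i hi; simpa using hi
  · intro i _ j _ hij; exact (Equiv.injective _) hij
  · intro j hj
    exact ⟨(Tuple.sort (fun j => ‖x - x' j‖)).symm j, by simpa using hj, by simp⟩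

theorem norm_sub_nearestNeighbor_mono {E : Type*} [NormedAddCommGroup E] {m : ℕ}
    (x' : Fin m → E) (x : E) : Monotone fun l => ‖x - nearestNeighbor x' l x‖ :=
  Tuple.monotone_sort (fun j => ‖x - x' j‖)

/-- The space splits into finitely many pieces according to the sorting permutation. Each is cut out
by comparisons of distances, and on it the neighbour is a coordinate. -/
theorem measurable_nearestNeighbor {E : Type*} [NormedAddCommGroup E] [MeasurableSpace E]
    [BorelSpace E] [SecondCountableTopology E] {m : ℕ} (l : Fin m) :
    Measurable fun z : E × (Fin m → E) => nearestNeighbor z.2 l z.1 := by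
  have hd : ∀ j, Measurable fun z : E × (Fin m → E) => ‖z.1 - z.2 j‖ := by
    intro j
    fun_prop
  have hset : ∀ σ : Equiv.Perm (Fin m),
      MeasurableSet {z : E × (Fin m → E) | σ = Tuple.sort fun j => ‖z.1 - z.2 j‖} := by
    intro σ
    simp only [Tuple.eq_sort_iff, Monotone, Function.comp_apply, Set.ofPred_and, Set.ofPred_forall]
    refine MeasurableSet.inter ?_ ?_
    · exact MeasurableSet.iInter fun i => MeasurableSet.iInter fun j =>
        MeasurableSet.iInter fun _ => measurableSet_le (hd _) (hd _)
    · refine MeasurableSet.iInter fun i => MeasurableSet.iInter fun j =>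
        MeasurableSet.iInter fun _ => ?_
      by_cases h : σ i < σ j
      · simp [h]
      · convert (measurableSet_eq_fun (hd (σ i)) (hd (σ j))).compl using 1
        ext z
        simp [h]
  intro s hs
  have : (fun z : E × (Fin m → E) => nearestNeighbor z.2 l z.1) ⁻¹' s =
      ⋃ σ : Equiv.Perm (Fin m), {z | σ = Tuple.sort fun j => ‖z.1 - z.2 j‖} ∩
        (fun z => z.2 (σ l)) ⁻¹' s := by
    ext z; simp [nearestNeighbor]
  rw [this]
  exact MeasurableSet.iUnion fun σ =>
    (hset σ).inter (((measurable_pi_apply _).comp measurable_snd) hs)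

/-- The error of the estimator is bounded by the Monte Carlo error and the distances to the
neighbours. -/
theorem abs_sub_qiEstimator_le {E : Type*} [NormedAddCommGroup E] {m n k : ℕ} (hk : 1 ≤ k)
    (hkm : k ≤ m) {g : E → ℝ} {L : ℝ≥0} (hg : LipschitzWith L g) (x' : Fin m → E)
    (x : Fin n → E) (a : ℝ) :
    |a - qiEstimator k x' (fun j => g (x' j)) x| ≤
      |a - 1 / (n : ℝ) * ∑ i, g (x i)| + L * (1 / (n : ℝ) *
        ∑ i, ‖x i - nearestNeighbor x' ⟨k - 1, by omega⟩ (x i)‖) := by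
  have hk0 : (0 : ℝ) < k := by exact_mod_cast hk
  have hcard : (Finset.univ.filter fun l : Fin m => l.val < k).card = k := by
    rw [Fin.card_filter_val_lt]; omega
  have hpt : ∀ y, |g y - knnRegression k x' (fun j => g (x' j)) y| ≤
      L * ‖y - nearestNeighbor x' ⟨k - 1, by omega⟩ y‖ := by
    intro y
    have e : g y - knnRegression k x' (fun j => g (x' j)) y =
        1 / (k : ℝ) * ∑ l with (l : Fin m).val < k, (g y - g (nearestNeighbor x' l y)) := by
      simp only [knnRegression, apply_nearestNeighborIndex, Finset.sum_sub_distrib,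
        Finset.sum_const, hcard, nsmul_eq_mul]
      field_simp
    rw [e, abs_mul, abs_of_nonneg (by positivity), one_div, inv_mul_le_iff₀ hk0]
    refine (Finset.abs_sum_le_sum_abs _ _).trans ((Finset.sum_le_card_nsmul _ _ _ ?_).trans_eq
      (by rw [hcard, nsmul_eq_mul]))
    intro l hl
    have hl' : l.val < k := by simpa using hl
    refine (hg.norm_sub_le y _).trans (mul_le_mul_of_nonneg_left ?_ L.2)
    exact norm_sub_nearestNeighbor_mono x' y (by rw [Fin.le_def]; simp; omega)
  have e : a - qiEstimator k x' (fun j => g (x' j)) x = (a - 1 / (n : ℝ) * ∑ i, g (x i)) +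
      1 / (n : ℝ) * ∑ i, (g (x i) - knnRegression k x' (fun j => g (x' j)) (x i)) := by
    rw [qiEstimator, Finset.sum_sub_distrib]; ring
  rw [e]
  refine (abs_add_le _ _).trans (add_le_add le_rfl ?_)
  rw [abs_mul, abs_of_nonneg (by positivity), mul_left_comm, Finset.mul_sum]
  exact mul_le_mul_of_nonneg_left ((Finset.abs_sum_le_sum_abs _ _).trans
    (Finset.sum_le_sum fun i _ => hpt _)) (by positivity)

/-! ### Number of sample points in a set -/

/-- A Chernoff bound for the number of points of an i.i.d. sample in a set. -/
theorem measureReal_card_lt_le {Ω E : Type*} [MeasurableSpace Ω] [MeasurableSpace E]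
    (P : Measure Ω) [IsProbabilityMeasure P] (ν : Measure E) [IsProbabilityMeasure ν]
    {ξ : ℕ → Ω → E} (hξ : ∀ j, Measurable (ξ j)) (hlaw : ∀ j, P.map (ξ j) = ν)
    (hind : iIndepFun ξ P) (p : E → Prop) [DecidablePred p] (hp : MeasurableSet {y | p y})
    (m k : ℕ) {u : ℝ} (hu : 0 < u) (hu1 : u ≤ 1) :
    P.real {ω | (Finset.univ.filter fun j : Fin m => p (ξ j ω)).card < k} ≤
      (ν.real {y | ¬ p y} + u * ν.real {y | p y}) ^ m / u ^ k := by
  -- The product of the weights is `u` to the number of points in the set, hence at least `u ^ k`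
  -- when that number is below `k`. Markov's inequality then applies.
  set w : E → ℝ := fun y => if p y then u else 1 with hw
  have hwm : Measurable w := Measurable.ite hp measurable_const measurable_const
  have hw0 : ∀ y, 0 ≤ w y := fun y => by simp only [hw]; split_ifs <;> linarith
  have hw1 : ∀ y, w y ≤ 1 := fun y => by simp only [hw]; split_ifs <;> linarith
  have hint : ∀ j, ∫ ω, w (ξ j ω) ∂P = ν.real {y | ¬ p y} + u * ν.real {y | p y} := by
    intro j
    rw [← integral_map (hξ j).aemeasurable hwm.aestronglyMeasurable, hlaw]
    have e : w = fun y => ({y | ¬ p y}.indicator (fun _ => (1 : ℝ)) y) +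
        u * ({y | p y}.indicator (fun _ => (1 : ℝ)) y) := by
      ext y; by_cases h : p y <;> simp [hw, h]
    have hp' : MeasurableSet {y | ¬ p y} := hp.compl
    rw [e, integral_add ((integrable_const _).indicator hp')
      (((integrable_const _).indicator hp).const_mul u), integral_const_mul,
      integral_indicator_const _ hp, integral_indicator_const _ hp']
    simp
  have hprod : ∫ ω, ∏ j : Fin m, w (ξ j ω) ∂P =
      (ν.real {y | ¬ p y} + u * ν.real {y | p y}) ^ m := by
    have hi : iIndepFun (fun (j : Fin m) ω => w (ξ j ω)) P :=
      (hind.comp (fun _ => w) fun _ => hwm).precomp Fin.val_injective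
    rw [hi.integral_fun_prod_eq_prod_integral
      fun j => (hwm.comp (hξ j)).aestronglyMeasurable]
    simp [hint]
  have hpm : Measurable fun ω => ∏ j : Fin m, w (ξ j ω) :=
    Finset.measurable_fun_prod _ fun j _ => hwm.comp (hξ j)
  have hpi : Integrable (fun ω => ∏ j : Fin m, w (ξ j ω)) P := by
    refine (integrable_const (1 : ℝ)).mono' hpm.aestronglyMeasurable (ae_of_all _ fun ω => ?_)
    rw [Real.norm_of_nonneg (Finset.prod_nonneg fun j _ => hw0 _)]
    exact Finset.prod_le_one (fun j _ => hw0 _) fun j _ => hw1 _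
  have hM := mul_meas_ge_le_integral_of_nonneg
    (ae_of_all P fun ω => Finset.prod_nonneg fun (j : Fin m) _ => hw0 (ξ j ω)) hpi (u ^ k)
  rw [hprod] at hM
  rw [le_div_iff₀ (by positivity), mul_comm]
  refine le_trans (mul_le_mul_of_nonneg_left (measureReal_mono ?_) (by positivity)) hM
  intro ω hω
  simp only [Set.mem_ofPred_eq, hw, Finset.prod_ite, Finset.prod_const, one_pow, mul_one] at hω ⊢
  exact pow_le_pow_of_le_one hu.le hu1 hω.le

/-- If the guaranteed mean count `m * G` is below `4 * k`, the right side is at least `1`. Otherwise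
Chernoff with `u = 1 / 2` gives `exp (-m * G / 4)`, which is weakened to a power of arbitrary order
`s`. -/
theorem measureReal_card_lt_le_of_le_mass {Ω E : Type*} [MeasurableSpace Ω] [MeasurableSpace E]
    (P : Measure Ω) [IsProbabilityMeasure P] (ν : Measure E) [IsProbabilityMeasure ν]
    {ξ : ℕ → Ω → E} (hξ : ∀ j, Measurable (ξ j)) (hlaw : ∀ j, P.map (ξ j) = ν)
    (hind : iIndepFun ξ P) (p : E → Prop) [DecidablePred p] (hp : MeasurableSet {y | p y})
    {m k : ℕ} (hm : 1 ≤ m) (hk : 1 ≤ k) {G : ℝ} (hG : 0 < G) (hGp : G ≤ ν.real {y | p y})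
    (s : ℕ) :
    P.real {ω | (Finset.univ.filter fun j : Fin m => p (ξ j ω)).card < k} ≤
      4 ^ s * (s.factorial : ℝ) * (k / (m * G)) ^ s := by
  have hm0 : (0 : ℝ) < m := by exact_mod_cast hm
  have hk0 : (1 : ℝ) ≤ k := by exact_mod_cast hk
  have hf : (1 : ℝ) ≤ s.factorial := by exact_mod_cast s.factorial_pos
  rcases lt_or_ge (m * G) (4 * k) with h | h
  · refine measureReal_le_one.trans ?_
    have h1 : 1 ≤ 4 * (k / (m * G)) := by
      rw [← mul_div_assoc, one_le_div (by positivity)]; exact h.le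
    have h2 : 1 ≤ 4 ^ s * (k / (m * G)) ^ s := by
      rw [← mul_pow]; exact one_le_pow₀ h1
    nlinarith
  · have hb := measureReal_card_lt_le P ν hξ hlaw hind p hp m k
      (u := 1 / 2) (by norm_num) (by norm_num)
    have hc : ν.real {y | ¬ p y} = 1 - ν.real {y | p y} := by
      have := probReal_compl_eq_one_sub (μ := ν) hp
      exact this
    have h1 : (ν.real {y | ¬ p y} + 1 / 2 * ν.real {y | p y}) ^ m ≤
        Real.exp (-(m * G / 2)) := by
      have e : Real.exp (-(m * G / 2)) = Real.exp (-(G / 2)) ^ m := by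
        rw [← Real.exp_nat_mul]; congr 1; ring
      rw [e]
      refine pow_le_pow_left₀ (by positivity) ?_ m
      have := Real.add_one_le_exp (-(G / 2))
      rw [hc]; linarith
    have h2 : (2 : ℝ) ^ k ≤ Real.exp (m * G / 4) := by
      calc (2 : ℝ) ^ k ≤ Real.exp 1 ^ k :=
            pow_le_pow_left₀ (by norm_num) Real.exp_one_gt_two.le k
        _ = Real.exp k := by rw [← Real.exp_nat_mul, mul_one]
        _ ≤ _ := Real.exp_le_exp.2 (by linarith)
    set y := m * G / 4 with hy
    have hy0 : 0 < y := by positivity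
    have h3 := Real.pow_div_factorial_le_exp y hy0.le s
    calc _ ≤ _ := hb
      _ = (ν.real {y | ¬ p y} + 1 / 2 * ν.real {y | p y}) ^ m * 2 ^ k := by
          rw [one_div, inv_pow, div_inv_eq_mul]
      _ ≤ Real.exp (-(m * G / 2)) * Real.exp y := mul_le_mul h1 h2 (by positivity) (by positivity)
      _ = (Real.exp y)⁻¹ := by
          rw [← Real.exp_add, ← Real.exp_neg]; congr 1; rw [hy]; ring
      _ ≤ (y ^ s / s.factorial)⁻¹ := inv_anti₀ (by positivity) h3
      _ = 4 ^ s * s.factorial * (1 / (m * G)) ^ s := by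
          rw [hy, inv_div, div_pow, div_pow, one_pow]; field_simp
      _ ≤ _ := by gcongr

/-- The regime of nearly full mass: Chernoff with `u = h` gives `(2 * h) ^ m / h ^ k`, and `k ≤ m /
2` leaves a factor `h ^ (m / 2)`. -/
theorem measureReal_card_lt_le_of_compl_le {Ω E : Type*} [MeasurableSpace Ω] [MeasurableSpace E]
    (P : Measure Ω) [IsProbabilityMeasure P] (ν : Measure E) [IsProbabilityMeasure ν]
    {ξ : ℕ → Ω → E} (hξ : ∀ j, Measurable (ξ j)) (hlaw : ∀ j, P.map (ξ j) = ν)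
    (hind : iIndepFun ξ P) (p : E → Prop) [DecidablePred p] (hp : MeasurableSet {y | p y})
    {m k : ℕ} (hkm : 2 * k ≤ m) {h : ℝ} (h0 : 0 < h) (h1 : h ≤ 1)
    (hh : ν.real {y | ¬ p y} ≤ h) :
    P.real {ω | (Finset.univ.filter fun j : Fin m => p (ξ j ω)).card < k} ≤ √(4 * h) ^ m := by
  refine (measureReal_card_lt_le P ν hξ hlaw hind p hp m k h0 h1).trans ?_
  have e1 : √(4 * h) = 2 * √h := by
    rw [Real.sqrt_mul (by norm_num), show (4 : ℝ) = 2 ^ 2 by norm_num,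
      Real.sqrt_sq (by norm_num)]
  have hs : 0 < √h := Real.sqrt_pos.2 h0
  have hs1 : √h ≤ 1 := Real.sqrt_le_one.2 h1
  have hsq : √h ^ 2 = h := Real.sq_sqrt h0.le
  rw [e1, div_le_iff₀ (by positivity)]
  have hG : ν.real {y | p y} ≤ 1 := measureReal_le_one
  calc (ν.real {y | ¬ p y} + h * ν.real {y | p y}) ^ m ≤ (2 * h) ^ m := by
        refine pow_le_pow_left₀ (by positivity) ?_ m
        nlinarith
    _ = (2 * √h) ^ m * √h ^ m := by
        rw [← mul_pow, mul_assoc, ← sq, hsq]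
    _ ≤ (2 * √h) ^ m * √h ^ (2 * k) := mul_le_mul_of_nonneg_left
        (pow_le_pow_of_le_one hs.le hs1 hkm) (by positivity)
    _ = _ := by rw [pow_mul, hsq]

/-- If the minimum of `m₀` norms is integrable, the order statistics of the norms have polynomial
tails of any order, uniformly over the ranks `k ≤ m / 2` and over large `m`. -/
theorem measureReal_card_norm_le_lt_le {Ω E : Type*} [MeasurableSpace Ω] [NormedAddCommGroup E]
    [MeasurableSpace E] [BorelSpace E] (P : Measure Ω) [IsProbabilityMeasure P] (ν : Measure E)
    [IsProbabilityMeasure ν] {ξ : ℕ → Ω → E} (hξ : ∀ j, Measurable (ξ j))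
    (hlaw : ∀ j, P.map (ξ j) = ν) (hind : iIndepFun ξ P) {m₀ : ℕ} (hm₀ : 1 ≤ m₀) {A : ℝ}
    (hA : 0 < A) (htail : ∀ r, 0 < r → r * ν.real {y | ¬ ‖y‖ ≤ r} ^ m₀ ≤ A) {S : ℝ}
    {m k : ℕ} (hkm : 2 * k ≤ m) (hmS : 2 * m₀ * S ≤ m) (hS : 0 ≤ S) {r : ℝ} (hr : 0 < r) :
    P.real {ω | (Finset.univ.filter fun j : Fin m => ‖ξ j ω‖ ≤ r).card < k} ≤
      (4 ^ m₀ * A / r) ^ S := by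
  -- The factor `4 ^ m₀` makes `4 * h₁ = b ^ (1 / m₀)`, so the preceding bound becomes `b ^ (m / (2
  -- * m₀))`.
  set b := 4 ^ m₀ * A / r with hb
  have hb0 : 0 < b := by positivity
  have hm₀' : (0 : ℝ) < m₀ := by exact_mod_cast hm₀
  rcases le_or_gt 1 b with h | h
  · exact measureReal_le_one.trans (Real.one_le_rpow h hS)
  set h₁ := b ^ (1 / (m₀ : ℝ)) / 4 with hh₁
  have hc0 : 0 < b ^ (1 / (m₀ : ℝ)) := Real.rpow_pos_of_pos hb0 _
  have hc1 : b ^ (1 / (m₀ : ℝ)) ≤ 1 := Real.rpow_le_one hb0.le h.le (by positivity)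
  have hpow : h₁ ^ m₀ = A / r := by
    rw [hh₁, div_pow, one_div, Real.rpow_inv_natCast_pow hb0.le (by omega), hb]
    field_simp
  have hH : ν.real {y | ¬ ‖y‖ ≤ r} ≤ h₁ := by
    refine le_of_pow_le_pow_left₀ (n := m₀) (by omega) (by positivity) ?_
    rw [hpow, le_div_iff₀ hr, mul_comm]
    exact htail r hr
  refine (measureReal_card_lt_le_of_compl_le P ν hξ hlaw hind (fun y => ‖y‖ ≤ r)
    (measurableSet_le measurable_norm measurable_const) hkm (by positivity)
    (by linarith) hH).trans ?_
  have e : √(4 * h₁) ^ m = b ^ ((m : ℝ) / (2 * m₀)) := by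
    rw [hh₁, mul_div_cancel₀ _ (by norm_num : (4 : ℝ) ≠ 0), Real.sqrt_eq_rpow,
      ← Real.rpow_natCast, ← Real.rpow_mul hb0.le, ← Real.rpow_mul hb0.le]
    congr 1; field_simp
  rw [e]
  refine Real.rpow_le_rpow_of_exponent_ge hb0 h.le ?_
  rw [le_div_iff₀ (by positivity)]; linarith

/-- Markov's inequality for the minimum, which exceeds `r` exactly when all `m₀` independent norms
do. The added `1` only makes `A` positive. -/
theorem exists_mul_measureReal_pow_le {Ω E : Type*} [MeasurableSpace Ω] [NormedAddCommGroup E]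
    [MeasurableSpace E] [BorelSpace E] (P : Measure Ω) [IsProbabilityMeasure P] (ν : Measure E)
    {ξ : ℕ → Ω → E} (hξ : ∀ j, Measurable (ξ j))
    (hlaw : ∀ j, P.map (ξ j) = ν) (hind : iIndepFun ξ P) (hmin : MinIntegrable P ξ) :
    ∃ (m₀ : ℕ) (A : ℝ), 1 ≤ m₀ ∧ 0 < A ∧
      ∀ r, 0 < r → r * ν.real {y | ¬ ‖y‖ ≤ r} ^ m₀ ≤ A := by
  obtain ⟨m₀, hm₀, hint⟩ := hmin
  have : Nonempty (Fin m₀) := ⟨⟨0, hm₀⟩⟩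
  have h0 : ∀ ω, 0 ≤ ⨅ j : Fin m₀, ‖ξ j ω‖ := fun ω => Real.iInf_nonneg fun _ => norm_nonneg _
  refine ⟨m₀, ∫ ω, (⨅ j : Fin m₀, ‖ξ j ω‖) ∂P + 1, hm₀,
    by linarith [integral_nonneg (μ := P) (f := fun ω => ⨅ j : Fin m₀, ‖ξ j ω‖) h0], fun r hr => ?_⟩
  have hB : MeasurableSet {y : E | ¬ ‖y‖ ≤ r} :=
    (measurableSet_le measurable_norm measurable_const).compl
  have hpr := hind.measure_inter_preimage_eq_mul (Finset.range m₀)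
    (sets := fun _ => {y : E | ¬ ‖y‖ ≤ r}) fun _ _ => hB
  have e : ∀ j, P (ξ j ⁻¹' {y : E | ¬ ‖y‖ ≤ r}) = ν {y : E | ¬ ‖y‖ ≤ r} := fun j => by
    rw [← hlaw j, Measure.map_apply (hξ j) hB]
  simp only [e, Finset.prod_const, Finset.card_range] at hpr
  have hM := mul_meas_ge_le_integral_of_nonneg (ae_of_all P h0) hint r
  rw [measureReal_def, ← ENNReal.toReal_pow, ← hpr, ← measureReal_def]
  refine (mul_le_mul_of_nonneg_left (measureReal_mono ?_) hr.le).trans (hM.trans (by linarith))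
  intro ω hω
  simp only [Set.mem_iInter, Finset.mem_range, Set.mem_preimage, Set.mem_ofPred_eq, not_le] at hω ⊢
  exact le_ciInf fun j => (hω j j.2).le

/-! ### Tails and moments of the distance to a neighbour. -/

theorem measureReal_lt_norm_sub_nearestNeighbor_le {Ω E : Type*} [MeasurableSpace Ω]
    [NormedAddCommGroup E] [MeasurableSpace E] [BorelSpace E] (P : Measure Ω)
    [IsProbabilityMeasure P] (ν : Measure E) [IsProbabilityMeasure ν]
    {ξ : ℕ → Ω → E} (hξ : ∀ j, Measurable (ξ j)) (hlaw : ∀ j, P.map (ξ j) = ν)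
    (hind : iIndepFun ξ P) {m : ℕ} (l : Fin m) (x : E) {r G : ℝ} (hG : 0 < G)
    (hGx : G ≤ ν.real (Metric.closedBall x r)) (s : ℕ) :
    P.real {ω | r < ‖x - nearestNeighbor (fun j : Fin m => ξ j ω) l x‖} ≤
      4 ^ s * (s.factorial : ℝ) * ((l + 1 : ℕ) / (m * G)) ^ s := by
  have e : Metric.closedBall x r = {y | ‖x - y‖ ≤ r} := by
    ext y; rw [Metric.mem_closedBall', dist_eq_norm]; rfl
  have hB : MeasurableSet {y | ‖x - y‖ ≤ r} := e ▸ measurableSet_closedBall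
  rw [e] at hGx
  refine (measureReal_mono ?_).trans (measureReal_card_lt_le_of_le_mass P ν hξ hlaw hind
    (fun y => ‖x - y‖ ≤ r) hB (by have := l.2; omega) (Nat.succ_pos l) hG hGx s)
  intro ω hω
  exact Nat.lt_succ_of_le (card_le_of_lt_norm_sub_nearestNeighbor hω)

/-- For `r > 2 * ‖x‖` the ball around `x` contains the ball of radius `r / 2` around `0`, so the
tail of the norms applies; for smaller `r` the right side is at least `1`. No density at `x` enters.
-/
theorem measureReal_lt_norm_sub_nearestNeighbor_le_rpow {Ω E : Type*} [MeasurableSpace Ω]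
    [NormedAddCommGroup E] [MeasurableSpace E] [BorelSpace E] (P : Measure Ω)
    [IsProbabilityMeasure P] (ν : Measure E) [IsProbabilityMeasure ν]
    {ξ : ℕ → Ω → E} (hξ : ∀ j, Measurable (ξ j)) (hlaw : ∀ j, P.map (ξ j) = ν)
    (hind : iIndepFun ξ P) {m₀ : ℕ} (hm₀ : 1 ≤ m₀) {A : ℝ}
    (hA : 0 < A) (htail : ∀ r, 0 < r → r * ν.real {y | ¬ ‖y‖ ≤ r} ^ m₀ ≤ A) {S : ℝ} (hS : 0 ≤ S)
    {m : ℕ} {l : Fin m} (hlm : 2 * (l.val + 1) ≤ m) (hmS : 2 * m₀ * S ≤ m) (x : E) {r : ℝ}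
    (hr : 0 < r) :
    P.real {ω | r < ‖x - nearestNeighbor (fun j : Fin m => ξ j ω) l x‖} ≤
      ((2 * ‖x‖ + 2 * (4 ^ m₀ * A)) / r) ^ S := by
  have hR : 0 < 4 ^ m₀ * A := by positivity
  rcases le_or_gt r (2 * ‖x‖) with h | h
  · refine measureReal_le_one.trans (Real.one_le_rpow ?_ hS)
    rw [one_le_div hr]; linarith
  · refine (measureReal_mono ?_).trans ((measureReal_card_norm_le_lt_le P ν hξ hlaw hind hm₀ hA
      htail hlm hmS hS (half_pos hr)).trans (Real.rpow_le_rpow (by positivity) ?_ hS))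
    · intro ω hω
      refine Nat.lt_succ_of_le ((Finset.card_le_card fun j hj => ?_).trans
        (card_le_of_lt_norm_sub_nearestNeighbor hω))
      simp only [Finset.mem_filter, Finset.mem_univ, true_and] at hj ⊢
      linarith [norm_sub_le x (ξ j ω)]
    · rw [div_div_eq_mul_div]
      gcongr
      linarith [norm_nonneg x]

set_option maxHeartbeats 1000000 in
/-- Moments of the distance from a fixed point to its nearest neighbours. -/
theorem exists_lintegral_norm_sub_nearestNeighbor_rpow_le {Ω E : Type*} [MeasurableSpace Ω]
    [NormedAddCommGroup E] [MeasurableSpace E] [BorelSpace E] [SecondCountableTopology E]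
    (P : Measure Ω) [IsProbabilityMeasure P] (ν : Measure E) [IsProbabilityMeasure ν]
    {ξ : ℕ → Ω → E} (hξ : ∀ j, Measurable (ξ j)) (hlaw : ∀ j, P.map (ξ j) = ν)
    (hind : iIndepFun ξ P) (hmin : MinIntegrable P ξ) {q : ℝ} (hq : 0 < q) {d : ℕ} (hd : 1 ≤ d)
    {c r₀ : ℝ} (hc : 0 < c) (hr₀ : 0 < r₀) {U : Set E} {p : E → ℝ} (hp : ∀ x ∈ U, 0 < p x)
    (hmass : ∀ x ∈ U, ∀ r : ℝ, 0 ≤ r → r ≤ r₀ →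
      c * p x * r ^ d ≤ ν.real (Metric.closedBall x r)) :
    ∃ C M : ℝ, 0 ≤ C ∧ ∀ m : ℕ, M ≤ m → ∀ l : Fin m, 2 * (l.val + 1) ≤ m → ∀ x ∈ U,
      ∫⁻ ω, ENNReal.ofReal (‖x - nearestNeighbor (fun j : Fin m => ξ j ω) l x‖ ^ q) ∂P ≤
        ENNReal.ofReal (C * (((l + 1 : ℕ) : ℝ) / m) ^ (q / d) *
          ((1 + ‖x‖ ^ q) / p x ^ (q / d))) := by
  obtain ⟨m₀, A, hm₀, hA, htail⟩ := exists_mul_measureReal_pow_le P ν hξ hlaw hind hmin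
  -- Then `d * s > q` makes the local moment converge, and `d * s ≥ 2 * q` survives the square root
  -- taken of `T` below.
  set s : ℕ := ⌈2 * (q + 1)⌉₊ with hs
  have hs' : 2 * (q + 1) ≤ s := Nat.le_ceil _
  set K : ℝ := 4 ^ s * s.factorial with hK
  have hK1 : 1 ≤ K := by
    have h1 : (1 : ℝ) ≤ s.factorial := by exact_mod_cast s.factorial_pos
    have h2 : (1 : ℝ) ≤ 4 ^ s := one_le_pow₀ (by norm_num)
    nlinarith
  set R₀ : ℝ := 4 ^ m₀ * A with hR₀
  have hR₀0 : 0 < R₀ := by positivity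
  have hd0 : (1 : ℝ) ≤ d := by exact_mod_cast hd
  have hds : 2 * (q + 1) ≤ ((d * s : ℕ) : ℝ) := by
    push_cast; nlinarith
  set C₁ : ℝ := K * (1 + q / (((d * s : ℕ) : ℝ) - q)) with hC₁
  have hC₁0 : 0 ≤ C₁ := by
    have : 0 < ((d * s : ℕ) : ℝ) - q := by linarith
    positivity
  set C₂ : ℝ := K * (1 / r₀) ^ q * (1 + q) * (4 ^ q * (1 + R₀ ^ q)) with hC₂
  have hC₂0 : 0 ≤ C₂ := by positivity
  refine ⟨(C₁ + C₂) * (1 / c) ^ (q / d), 2 * m₀ * (2 * (q + 1)), by positivity,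
    fun m hm l hlm x hx => ?_⟩
  have hm0 : (0 : ℝ) < m := by have := l.2; exact_mod_cast (by omega : 0 < m)
  have hpx := hp x hx
  set k : ℝ := ((l + 1 : ℕ) : ℝ) with hk
  have hk0 : 0 < k := by rw [hk]; positivity
  set w : ℝ := k / m * (1 / c) * (1 / p x) with hw
  have hw0 : 0 < w := by positivity
  -- The radius at which the lower bound on the mass of the ball equals `k / m`.
  set R₁ : ℝ := w ^ (1 / (d : ℝ)) with hR₁
  have hR₁0 : 0 < R₁ := Real.rpow_pos_of_pos hw0 _
  have hR₁d : R₁ ^ d = w := by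
    rw [hR₁, one_div, Real.rpow_inv_natCast_pow hw0.le (by omega)]
  have hR₁q : R₁ ^ q = (k / m) ^ (q / d) * (1 / c) ^ (q / d) * (1 / p x ^ (q / d)) := by
    rw [hR₁, ← Real.rpow_mul hw0.le, hw, Real.mul_rpow (by positivity) (by positivity),
      Real.mul_rpow (by positivity) (by positivity), one_div_mul_eq_div,
      Real.div_rpow zero_le_one hpx.le, Real.one_rpow]
  set R₂ : ℝ := 2 * ‖x‖ + 2 * R₀ with hR₂
  have hR₂0 : 0 < R₂ := by positivity
  set Z : Ω → ℝ := fun ω => ‖x - nearestNeighbor (fun j : Fin m => ξ j ω) l x‖ with hZ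
  have hZm : Measurable Z := by
    have h1 : Measurable fun ω => (x, fun j : Fin m => ξ j ω) :=
      measurable_const.prodMk (measurable_pi_lambda _ fun j => hξ j)
    exact (((measurable_nearestNeighbor l).comp h1).const_sub x).norm
  have hZ0 : ∀ ω, 0 ≤ Z ω := fun ω => norm_nonneg _
  have ta : ∀ r, 0 < r → r ≤ r₀ →
      P.real {ω | r < Z ω} ≤ K * (R₁ / r) ^ ((d * s : ℕ) : ℝ) := by
    intro r hr hrr
    refine (measureReal_lt_norm_sub_nearestNeighbor_le P ν hξ hlaw hind l x (by positivity)
      (hmass x hx r hr.le hrr) s).trans_eq ?_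
    rw [Real.rpow_natCast, pow_mul, div_pow R₁ r d, hR₁d, hw, ← hk, hK]
    congr 2; field_simp
  have tb : ∀ r, 0 < r → P.real {ω | r < Z ω} ≤ (R₂ / r) ^ (2 * (q + 1)) := fun r hr =>
    measureReal_lt_norm_sub_nearestNeighbor_le_rpow P ν hξ hlaw hind hm₀ hA htail
      (by linarith) hlm hm x hr
  -- The local tail is known only up to `r₀`; truncating the distance there makes the bound hold for
  -- all `r`.
  have t1 := lintegral_rpow_le_of_tail_le P (Z := fun ω => min (Z ω) r₀)
    (hZm.min measurable_const) (fun ω => le_min (hZ0 ω) hr₀.le) hq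
    (show q < ((d * s : ℕ) : ℝ) by linarith) (zero_le_one.trans hK1) hR₁0
    (fun r _ => measureReal_le_one.trans hK1) (fun r hr => by
      rcases lt_or_ge r r₀ with h | h
      · refine (measureReal_mono fun ω hω => ?_).trans (ta r hr h.le)
        exact lt_of_lt_of_le (show r < min (Z ω) r₀ from hω) (min_le_left _ _)
      · have : {ω | r < min (Z ω) r₀} = ∅ := by
          ext ω
          simp only [Set.mem_ofPred_eq, lt_min_iff, Set.mem_empty_iff_false, iff_false, not_and,
            not_lt]
          exact fun _ => h
        rw [this, measureReal_empty]
        positivity)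
  set T : ℝ := P.real {ω | r₀ < Z ω} with hT
  have hT1 : T ≤ 1 := measureReal_le_one
  have hT0 : 0 ≤ T := measureReal_nonneg
  have hTs : T ≤ √T := by
    have h1 := Real.sqrt_nonneg T
    have h2 := Real.mul_self_sqrt hT0
    have h3 : √T ≤ 1 := Real.sqrt_le_one.2 hT1
    nlinarith
  have hZ2 : ∀ r, 0 < r → ∀ ω, r < (if r₀ < Z ω then Z ω else 0) → r₀ < Z ω ∧ r < Z ω := by
    intro r hr ω hω
    split_ifs at hω with h
    · exact ⟨h, hω⟩
    · exact absurd hω (not_lt.2 hr.le)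
  -- Beyond `r₀` the far tail alone carries no rate in `m`. Its geometric mean with `T` decays with
  -- exponent `q + 1 > q` and keeps a factor `√T`, which is of order `R₁ ^ q`.
  have t2 := lintegral_rpow_le_of_tail_le P (Z := fun ω => if r₀ < Z ω then Z ω else 0)
    (Measurable.ite (measurableSet_lt measurable_const hZm) hZm measurable_const)
    (fun ω => by split_ifs; exacts [hZ0 ω, le_rfl]) hq
    (show q < q + 1 by linarith) (Real.sqrt_nonneg T) hR₂0
    (fun r hr => (measureReal_mono fun ω hω => (hZ2 r hr ω hω).1).trans hTs) (fun r hr => by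
      set t := P.real {ω | r < (if r₀ < Z ω then Z ω else 0)}
      have b1 : t ≤ T := measureReal_mono fun ω hω => (hZ2 r hr ω hω).1
      have b2 : t ≤ (R₂ / r) ^ (2 * (q + 1)) :=
        (measureReal_mono fun ω hω => (hZ2 r hr ω hω).2).trans (tb r hr)
      have ht0 : 0 ≤ t := measureReal_nonneg
      have b3 : √t ≤ (R₂ / r) ^ (q + 1) := by
        refine Real.sqrt_le_iff.2 ⟨by positivity, b2.trans_eq ?_⟩
        rw [← Real.rpow_natCast, ← Real.rpow_mul (by positivity)]
        congr 1; push_cast; ring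
      calc t = √t * √t := (Real.mul_self_sqrt ht0).symm
        _ ≤ √T * (R₂ / r) ^ (q + 1) :=
          mul_le_mul (Real.sqrt_le_sqrt b1) b3 (Real.sqrt_nonneg _) (Real.sqrt_nonneg _))
  have hTb : √T ≤ K * (R₁ / r₀) ^ q := by
    rcases le_or_gt 1 (R₁ / r₀) with h | h
    · have h1 := Real.one_le_rpow h hq.le
      exact (Real.sqrt_le_one.2 hT1).trans (one_le_mul_of_one_le_of_one_le hK1 h1)
    · refine Real.sqrt_le_iff.2 ⟨by positivity, (ta r₀ hr₀ le_rfl).trans ?_⟩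
      have h1 : (R₁ / r₀) ^ ((d * s : ℕ) : ℝ) ≤ (R₁ / r₀) ^ (q * 2) :=
        Real.rpow_le_rpow_of_exponent_ge (by positivity) h.le (by linarith)
      have h2 : (R₁ / r₀) ^ (q * 2) = ((R₁ / r₀) ^ q) ^ 2 := by
        rw [Real.rpow_mul (by positivity)]; norm_num
      rw [h2] at h1
      rw [mul_pow]
      exact mul_le_mul (le_self_pow₀ hK1 two_ne_zero) h1 (by positivity) (by positivity)
  have hR₂q : R₂ ^ q ≤ 4 ^ q * (1 + R₀ ^ q) * (1 + ‖x‖ ^ q) := by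
    have hx0 : 0 ≤ ‖x‖ ^ q := by positivity
    have hr0 : 0 ≤ R₀ ^ q := by positivity
    have h1 : R₂ ≤ 4 * max ‖x‖ R₀ := by
      linarith [le_max_left ‖x‖ R₀, le_max_right ‖x‖ R₀]
    have h2 : (max ‖x‖ R₀) ^ q ≤ ‖x‖ ^ q + R₀ ^ q := by
      rcases max_cases ‖x‖ R₀ with h | h <;> rw [h.1] <;> linarith
    calc R₂ ^ q ≤ (4 * max ‖x‖ R₀) ^ q := Real.rpow_le_rpow hR₂0.le h1 hq.le
      _ = 4 ^ q * (max ‖x‖ R₀) ^ q := Real.mul_rpow (by norm_num) (by positivity)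
      _ ≤ 4 ^ q * ((1 + R₀ ^ q) * (1 + ‖x‖ ^ q)) := by
          refine mul_le_mul_of_nonneg_left ?_ (by positivity)
          nlinarith
      _ = _ := by ring
  calc ∫⁻ ω, ENNReal.ofReal (Z ω ^ q) ∂P
      ≤ ∫⁻ ω, (ENNReal.ofReal ((min (Z ω) r₀) ^ q) +
          ENNReal.ofReal ((if r₀ < Z ω then Z ω else 0) ^ q)) ∂P := by
        refine lintegral_mono fun ω => ?_
        split_ifs with h
        · exact le_add_self
        · rw [min_eq_left (not_lt.1 h)]; exact le_self_add
    _ ≤ ENNReal.ofReal (C₁ * R₁ ^ q) +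
          ENNReal.ofReal (√T * (1 + q / (q + 1 - q)) * R₂ ^ q) := by
        rw [lintegral_add_left (((hZm.min measurable_const).pow_const q).ennreal_ofReal)]
        exact add_le_add t1 t2
    _ ≤ _ := by
        rw [← ENNReal.ofReal_add (by positivity) (by rw [add_sub_cancel_left]; positivity)]
        refine ENNReal.ofReal_le_ofReal ?_
        rw [add_sub_cancel_left, div_one]
        have hx0 : 0 ≤ ‖x‖ ^ q := by positivity
        have h1 : C₁ * R₁ ^ q ≤ C₁ * R₁ ^ q * (1 + ‖x‖ ^ q) := by
          have : 0 ≤ C₁ * R₁ ^ q := by positivity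
          nlinarith
        have h2 : √T * (1 + q) * R₂ ^ q ≤ C₂ * R₁ ^ q * (1 + ‖x‖ ^ q) := by
          calc √T * (1 + q) * R₂ ^ q ≤ (K * (R₁ / r₀) ^ q) * (1 + q) *
                (4 ^ q * (1 + R₀ ^ q) * (1 + ‖x‖ ^ q)) := by gcongr
            _ = _ := by
                rw [hC₂, div_eq_mul_one_div R₁ r₀, Real.mul_rpow hR₁0.le (by positivity)]
                ring
        refine (add_le_add h1 h2).trans_eq ?_
        rw [hR₁q]; ring

/-! ### Integrability, Monte Carlo error and assembly of the error bound. -/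

theorem add_rpow_le_two_rpow_mul {a b q : ℝ} (ha : 0 ≤ a) (hb : 0 ≤ b) (hq : 0 ≤ q) :
    (a + b) ^ q ≤ 2 ^ q * (a ^ q + b ^ q) := by
  have h1 : a + b ≤ 2 * max a b := by linarith [le_max_left a b, le_max_right a b]
  have ha' : 0 ≤ a ^ q := Real.rpow_nonneg ha _
  have hb' : 0 ≤ b ^ q := Real.rpow_nonneg hb _
  have h2 : (max a b) ^ q ≤ a ^ q + b ^ q := by
    rcases max_cases a b with h | h <;> rw [h.1] <;> linarith
  calc (a + b) ^ q ≤ (2 * max a b) ^ q := Real.rpow_le_rpow (by positivity) h1 hq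
    _ = 2 ^ q * (max a b) ^ q := Real.mul_rpow (by norm_num) (le_max_of_le_left ha)
    _ ≤ _ := mul_le_mul_of_nonneg_left h2 (by positivity)

/-- The strong support condition bounds the density, so that the moment condition controls the
moment of order `q` of `μX`. -/
theorem memLp_id_of_momentCondition {E : Type*} [NormedAddCommGroup E] [MeasurableSpace E]
    [BorelSpace E] [SecondCountableTopology E] {μ ν : Measure E} [IsProbabilityMeasure μ]
    [IsProbabilityMeasure ν] {d : ℕ} {q : ℝ} (hq : 0 < q) {c r₀ : ℝ} (hc : 0 < c)
    (hr₀ : 0 < r₀) {U : Set E} {p : E → ℝ} (hp : ∀ x ∈ U, 0 < p x)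
    (hmass : ∀ x ∈ U, ∀ r : ℝ, 0 ≤ r → r ≤ r₀ →
      c * p x * r ^ d ≤ ν.real (Metric.closedBall x r)) (hU : ∀ᵐ x ∂μ, x ∈ U)
    (hmom : MomentCondition d q μ p) : MemLp (fun x : E => x) (ENNReal.ofReal q) μ := by
  refine (integrable_norm_rpow_iff aestronglyMeasurable_id (by simpa using hq)
    ENNReal.ofReal_ne_top).1 ?_
  rw [ENNReal.toReal_ofReal hq.le]
  refine (Integrable.const_mul hmom ((1 / (c * r₀ ^ d)) ^ (q / d))).mono'
    (measurable_norm.pow_const q).aestronglyMeasurable (hU.mono fun x hx => ?_)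
  have hpx := hp x hx
  have hx0 : 0 ≤ ‖x‖ ^ q := by positivity
  have h1 : p x ≤ 1 / (c * r₀ ^ d) := by
    rw [le_div_iff₀ (by positivity)]
    have := (hmass x hx r₀ hr₀.le le_rfl).trans measureReal_le_one
    linarith
  have h2 : p x ^ (q / d) ≤ (1 / (c * r₀ ^ d)) ^ (q / d) :=
    Real.rpow_le_rpow hpx.le h1 (by positivity)
  rw [Real.norm_of_nonneg (by positivity), ← mul_div_assoc,
    le_div_iff₀ (Real.rpow_pos_of_pos hpx _), mul_comm]
  exact mul_le_mul h2 (le_add_of_nonneg_left zero_le_one) hx0 (by positivity)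

theorem memLp_of_lipschitzWith {E : Type*} [NormedAddCommGroup E] [MeasurableSpace E]
    [BorelSpace E] [SecondCountableTopology E] {μ : Measure E} [IsFiniteMeasure μ] {p : ℝ≥0∞}
    (hμ : MemLp (fun x : E => x) p μ) {g : E → ℝ} {L : ℝ≥0} (hg : LipschitzWith L g) :
    MemLp g p μ := by
  refine MemLp.mono' ((memLp_const |g 0|).add (hμ.norm.const_mul (L : ℝ)))
    hg.continuous.measurable.aestronglyMeasurable (ae_of_all _ fun x => ?_)
  have h1 := hg.norm_sub_le x 0
  have h2 := norm_add_le (g 0) (g x - g 0)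
  rw [add_sub_cancel] at h2
  rw [sub_zero] at h1
  simpa using h2.trans (add_le_add le_rfl h1)

/-- Monte Carlo rate in `L^q`. -/
theorem exists_integral_abs_sub_average_rpow_le {Ω E : Type*} [MeasurableSpace Ω]
    [MeasurableSpace E] (P : Measure Ω) [IsProbabilityMeasure P] (μ : Measure E)
    [IsProbabilityMeasure μ] {X : ℕ → Ω → E} (hX : ∀ i, Measurable (X i))
    (hlaw : ∀ i, P.map (X i) = μ) (hind : iIndepFun X P) {q : ℝ} (hq : 2 ≤ q) {g : E → ℝ}
    (hg : Measurable g) (hgq : MemLp g (ENNReal.ofReal q) μ) :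
    ∃ A : ℝ, 0 ≤ A ∧ ∀ n : ℕ, 1 ≤ n →
      Integrable (fun ω => |∫ x, g x ∂μ - 1 / (n : ℝ) * ∑ i : Fin n, g (X i ω)| ^ q) P ∧
      ∫ ω, |∫ x, g x ∂μ - 1 / (n : ℝ) * ∑ i : Fin n, g (X i ω)| ^ q ∂P ≤
        (A / n) ^ (q / 2) := by
  have hq0 : 0 < q := by linarith
  set a := ∫ x, g x ∂μ with ha
  have hgm : Measurable fun x => g x - a := hg.sub_const a
  have hga : MemLp (fun x => g x - a) (ENNReal.ofReal q) μ := hgq.sub (memLp_const a)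
  have hgi : Integrable g μ := hgq.integrable (by rw [ENNReal.one_le_ofReal]; linarith)
  have hLq : ∀ i, MemLp (fun ω => g (X i ω) - a) (ENNReal.ofReal q) P := by
    intro i
    have h := hga
    rw [← hlaw i] at h
    exact h.comp_of_map (hX i).aemeasurable
  have hmean : ∀ i, ∫ ω, (g (X i ω) - a) ∂P = 0 := by
    intro i
    rw [← integral_map (f := fun x => g x - a) (hX i).aemeasurable hgm.aestronglyMeasurable,
      hlaw, integral_sub hgi (integrable_const _)]
    simp [ha]
  have hM : ∀ i, ∫ ω, |g (X i ω) - a| ^ q ∂P ≤ ∫ x, |g x - a| ^ q ∂μ := by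
    intro i
    have hm : Measurable fun x => |g x - a| ^ q := hgm.norm.pow_const q
    rw [← hlaw i, integral_map (hX i).aemeasurable hm.aestronglyMeasurable]
  obtain ⟨A, hA, hS⟩ := exists_integral_abs_sum_rpow_le P hq
    (hind.comp (fun _ x => g x - a) fun _ => hgm) (fun i => hgm.comp (hX i)) hLq hmean hM
  refine ⟨A, hA, fun n hn => ?_⟩
  have hn0 : (0 : ℝ) < n := by exact_mod_cast hn
  have e : ∀ ω, |a - 1 / (n : ℝ) * ∑ i : Fin n, g (X i ω)| ^ q =
      (1 / (n : ℝ)) ^ q * |∑ i ∈ Finset.range n, (g (X i ω) - a)| ^ q := by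
    intro ω
    rw [← Real.mul_rpow (by positivity) (abs_nonneg _),
      ← abs_of_nonneg (show 0 ≤ 1 / (n : ℝ) by positivity), ← abs_mul,
      abs_of_nonneg (show 0 ≤ 1 / (n : ℝ) by positivity), abs_sub_comm,
      Finset.sum_sub_distrib, Fin.sum_univ_eq_sum_range (fun i => g (X i ω))]
    congr 2
    simp only [Finset.sum_const, Finset.card_range, nsmul_eq_mul]
    field_simp
  have hi := (integral_abs_rpow_le_rpow_integral P hq0.le le_rfl hq0
    (memLp_finsetSum (Finset.range n) fun i _ => hLq i)).1
  simp only [e]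
  refine ⟨hi.const_mul _, ?_⟩
  rw [integral_const_mul]
  refine (mul_le_mul_of_nonneg_left (hS n hn) (by positivity)).trans_eq ?_
  have e2 : (1 / (n : ℝ)) ^ q = ((1 / (n : ℝ)) ^ 2) ^ (q / 2) := by
    rw [← Real.rpow_natCast, ← Real.rpow_mul (by positivity)]; congr 1; push_cast; ring
  rw [e2, ← Real.mul_rpow (by positivity) (by positivity)]
  congr 1; field_simp

/-- Independence and Tonelli: the evaluation point can be frozen, so that bounds at a fixed `x`
suffice. -/
theorem lintegral_norm_sub_nearestNeighbor_rpow_eq {Ω E : Type*} [MeasurableSpace Ω]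
    [NormedAddCommGroup E] [MeasurableSpace E] [BorelSpace E] [SecondCountableTopology E]
    (P : Measure Ω) [IsProbabilityMeasure P] {ξ : ℕ → Ω → E} (hξ : ∀ j, Measurable (ξ j))
    {X : Ω → E} (hX : Measurable X) {m : ℕ} (hind : IndepFun (fun ω (j : Fin m) => ξ j ω) X P)
    (l : Fin m) (q : ℝ) :
    ∫⁻ ω, ENNReal.ofReal (‖X ω - nearestNeighbor (fun j : Fin m => ξ j ω) l (X ω)‖ ^ q) ∂P =
      ∫⁻ x, ∫⁻ ω, ENNReal.ofReal (‖x - nearestNeighbor (fun j : Fin m => ξ j ω) l x‖ ^ q) ∂P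
        ∂(P.map X) := by
  have hξm : Measurable fun ω (j : Fin m) => ξ j ω := measurable_pi_lambda _ fun j => hξ j
  have hF : Measurable fun z : E × (Fin m → E) =>
      ENNReal.ofReal (‖z.1 - nearestNeighbor z.2 l z.1‖ ^ q) :=
    ((measurable_fst.sub (measurable_nearestNeighbor l)).norm.pow_const q).ennreal_ofReal
  have hmap := (indepFun_iff_map_prod_eq_prod_map_map hX.aemeasurable hξm.aemeasurable).1
    hind.symm
  have : IsProbabilityMeasure (P.map fun ω (j : Fin m) => ξ j ω) :=
    Measure.isProbabilityMeasure_map hξm.aemeasurable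
  rw [← lintegral_map (f := fun z : E × (Fin m → E) =>
      ENNReal.ofReal (‖z.1 - nearestNeighbor z.2 l z.1‖ ^ q)) hF (hX.prodMk hξm), hmap,
    lintegral_prod _ hF.aemeasurable]
  refine lintegral_congr fun x => ?_
  exact lintegral_map (hF.comp measurable_prodMk_left) hξm

theorem average_rpow_le {n : ℕ} (hn : 1 ≤ n) {q : ℝ} (hq : 1 ≤ q) {v : Fin n → ℝ}
    (hv : ∀ i, 0 ≤ v i) : (1 / (n : ℝ) * ∑ i, v i) ^ q ≤ 1 / (n : ℝ) * ∑ i, v i ^ q := by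
  have hn0 : (n : ℝ) ≠ 0 := by exact_mod_cast (by omega : n ≠ 0)
  have := Real.rpow_arith_mean_le_arith_mean_rpow Finset.univ (fun _ : Fin n => 1 / (n : ℝ)) v
    (fun _ _ => by positivity) (by simp [hn0]) (fun i _ => hv i) hq
  simpa only [← Finset.mul_sum] using this

theorem measurable_qiEstimator {Ω E : Type*} [MeasurableSpace Ω] [NormedAddCommGroup E]
    [MeasurableSpace E] [BorelSpace E] [SecondCountableTopology E] {m n k : ℕ}
    {x' : Fin m → Ω → E} (hx' : ∀ j, Measurable (x' j)) {x : Fin n → Ω → E}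
    (hx : ∀ i, Measurable (x i)) {g : E → ℝ} (hg : Measurable g) :
    Measurable fun ω => qiEstimator k (fun j => x' j ω) (fun j => g (x' j ω))
      (fun i => x i ω) := by
  -- The selected index matters only through its sample point, so measurability of the index itself
  -- is not needed.
  have e : ∀ ω l y, g (x' (nearestNeighborIndex (fun j => x' j ω) l y) ω) =
      g (nearestNeighbor (fun j => x' j ω) l y) := fun ω l y => by
    rw [← apply_nearestNeighborIndex]
  simp only [qiEstimator, knnRegression, e]
  refine (Finset.measurable_fun_sum _ fun i _ =>
    (Finset.measurable_fun_sum _ fun l _ => ?_).const_mul _).const_mul _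
  have h1 : Measurable fun ω => (x i ω, fun j => x' j ω) :=
    (hx i).prodMk (measurable_pi_lambda _ hx')
  exact hg.comp ((measurable_nearestNeighbor l).comp h1)

/-- `L^q` error of the estimator, in terms of moments of the Monte Carlo error and of the mean
distance to the neighbours. -/
theorem integrable_and_integral_abs_sub_qiEstimator_rpow_le {Ω E : Type*} [MeasurableSpace Ω]
    [NormedAddCommGroup E] [MeasurableSpace E] [BorelSpace E] [SecondCountableTopology E]
    (P : Measure Ω) [IsProbabilityMeasure P] {m n : ℕ} (hn : 1 ≤ n) (l : Fin m)
    {x' : Fin m → Ω → E} (hx' : ∀ j, Measurable (x' j)) {x : Fin n → Ω → E}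
    (hx : ∀ i, Measurable (x i)) {g : E → ℝ} {L : ℝ≥0} (hg : LipschitzWith L g) {q : ℝ}
    (hq : 1 ≤ q) (a : ℝ) {V W : ℝ}
    (hMCi : Integrable (fun ω => |a - 1 / (n : ℝ) * ∑ i, g (x i ω)| ^ q) P)
    (hMC : ∫ ω, |a - 1 / (n : ℝ) * ∑ i, g (x i ω)| ^ q ∂P ≤ V) (hW : 0 ≤ W)
    (hNN : ∀ i, ∫⁻ ω, ENNReal.ofReal
      (‖x i ω - nearestNeighbor (fun j => x' j ω) l (x i ω)‖ ^ q) ∂P ≤ ENNReal.ofReal W) :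
    Integrable (fun ω => |a - qiEstimator (l + 1) (fun j => x' j ω) (fun j => g (x' j ω))
      (fun i => x i ω)| ^ q) P ∧
    ∫ ω, |a - qiEstimator (l + 1) (fun j => x' j ω) (fun j => g (x' j ω))
      (fun i => x i ω)| ^ q ∂P ≤ 2 ^ q * (V + (L : ℝ) ^ q * W) := by
  have hq0 : 0 < q := by linarith
  set D : Fin n → Ω → ℝ := fun i ω =>
    ‖x i ω - nearestNeighbor (fun j => x' j ω) l (x i ω)‖ with hD
  have hDm : ∀ i, Measurable (D i) := fun i => by
    have h1 : Measurable fun ω => (x i ω, fun j => x' j ω) :=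
      (hx i).prodMk (measurable_pi_lambda _ hx')
    exact ((hx i).sub ((measurable_nearestNeighbor l).comp h1)).norm
  have hDi : ∀ i, Integrable (fun ω => D i ω ^ q) P := fun i =>
    (lintegral_ofReal_ne_top_iff_integrable ((hDm i).pow_const q).aestronglyMeasurable
      (ae_of_all _ fun ω => by positivity)).1 ((hNN i).trans_lt ENNReal.ofReal_lt_top).ne
  have hDW : ∀ i, ∫ ω, D i ω ^ q ∂P ≤ W := fun i => by
    rw [integral_eq_lintegral_of_nonneg_ae (ae_of_all _ fun ω => by positivity)
      ((hDm i).pow_const q).aestronglyMeasurable]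
    exact ENNReal.toReal_le_of_le_ofReal hW (hNN i)
  have hsumi : Integrable (fun ω => 1 / (n : ℝ) * ∑ i, D i ω ^ q) P :=
    (integrable_finsetSum _ fun i _ => hDi i).const_mul _
  have hsum : ∫ ω, 1 / (n : ℝ) * ∑ i, D i ω ^ q ∂P ≤ W := by
    have hn0 : (0 : ℝ) < n := by exact_mod_cast hn
    rw [integral_const_mul, integral_finsetSum _ fun i _ => hDi i, one_div, inv_mul_le_iff₀ hn0]
    refine (Finset.sum_le_card_nsmul _ _ _ fun i _ => hDW i).trans_eq ?_
    simp
  set err : Ω → ℝ := fun ω => a - qiEstimator (l + 1) (fun j => x' j ω)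
    (fun j => g (x' j ω)) (fun i => x i ω) with herr
  have herrm : Measurable err :=
    (measurable_qiEstimator hx' hx hg.continuous.measurable).const_sub a
  have hbound : ∀ ω, |err ω| ^ q ≤ 2 ^ q * (|a - 1 / (n : ℝ) * ∑ i, g (x i ω)| ^ q +
      (L : ℝ) ^ q * (1 / (n : ℝ) * ∑ i, D i ω ^ q)) := by
    intro ω
    have h1 := abs_sub_qiEstimator_le (k := l.val + 1) (by omega) l.2 hg (fun j => x' j ω)
      (fun i => x i ω) a
    have hs0 : 0 ≤ 1 / (n : ℝ) * ∑ i, D i ω :=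
      mul_nonneg (by positivity) (Finset.sum_nonneg fun i _ => norm_nonneg _)
    refine (Real.rpow_le_rpow (abs_nonneg _) h1 hq0.le).trans
      ((add_rpow_le_two_rpow_mul (abs_nonneg _) (mul_nonneg L.coe_nonneg hs0) hq0.le).trans ?_)
    refine mul_le_mul_of_nonneg_left (add_le_add le_rfl ?_) (by positivity)
    refine (Real.mul_rpow L.coe_nonneg hs0).trans_le (mul_le_mul_of_nonneg_left ?_ (by positivity))
    exact average_rpow_le hn hq fun i => norm_nonneg _
  have hbi : Integrable (fun ω => 2 ^ q * (|a - 1 / (n : ℝ) * ∑ i, g (x i ω)| ^ q +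
      (L : ℝ) ^ q * (1 / (n : ℝ) * ∑ i, D i ω ^ q))) P :=
    (hMCi.add (hsumi.const_mul _)).const_mul _
  have hi : Integrable (fun ω => |err ω| ^ q) P := by
    refine hbi.mono' (herrm.norm.pow_const q).aestronglyMeasurable (ae_of_all _ fun ω => ?_)
    rw [Real.norm_of_nonneg (by positivity)]
    exact hbound ω
  refine ⟨hi, (integral_mono hi hbi hbound).trans ?_⟩
  rw [integral_const_mul, integral_add hMCi (hsumi.const_mul _), integral_const_mul]
  gcongr

end CovariateShift

/-! ### The rate of convergence. -/

theorem proposition4p3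
    -- `E` is `ℝ^d` with an arbitrary norm, and `lam` is Lebesgue measure.
    {E : Type*} [NormedAddCommGroup E] [NormedSpace ℝ E] [FiniteDimensional ℝ E]
    [MeasurableSpace E] [BorelSpace E] (lam : Measure E) [lam.IsAddHaarMeasure]
    (d : ℕ) (hd : Module.finrank ℝ E = d) (hd_pos : 1 ≤ d)
    {T : Type*} [MeasurableSpace T] {e : ℕ}
    {Ω : Type*} [MeasurableSpace Ω] (P : Measure Ω) [IsProbabilityMeasure P]
    (μX μX' : Measure E) [IsProbabilityMeasure μX] [IsProbabilityMeasure μX']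
    (μΘ : Measure T) [IsProbabilityMeasure μΘ]
    (X' : ℕ → Ω → E) (Θ : ℕ → Ω → T) (X : ℕ → Ω → E)
    (hsample : CovariateShift.IsCovariateShiftSample P μX μX' μΘ X' Θ X)
    (f : E × T → EuclideanSpace ℝ (Fin e)) (hf : Measurable f)
    (φ : EuclideanSpace ℝ (Fin e) → ℝ)
    (hnoiseless : ∀ x θ θ', f (x, θ) = f (x, θ'))
    (hLip : ∃ L : ℝ≥0, ∀ θ, LipschitzWith L fun x => φ (f (x, θ)))
    (q : ℝ) (hq : 2 ≤ q)
    (hmin : CovariateShift.MinIntegrable P X')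
    (U : Set E) (p : E → ℝ) (hsupp : CovariateShift.StrongSupport d lam μX μX' U p)
    (hmom : CovariateShift.MomentCondition d q μX p)
    (τ : ℕ → ℝ≥0) (hτ : CovariateShift.IsEmpiricalRate P 1 μX X τ) :
    -- the quantity of interest is well defined
    Integrable (fun z => φ (f z)) (μX.prod μΘ) ∧
    -- the rate, uniformly over `n ≥ 1` and all large `m`
    (∀ k : ℕ → ℕ, CovariateShift.IsNeighborSequence k →
      ∃ C : ℝ, ∀ᶠ m : ℕ in atTop, ∀ n : ℕ, 1 ≤ n →
        Integrable (fun ω => |CovariateShift.quantityOfInterest μX μΘ f φ -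
          CovariateShift.qiEstimator (k m) (fun j : Fin m => X' j ω)
            (fun j : Fin m => φ (f (X' j ω, Θ j ω))) (fun i : Fin n => X i ω)| ^ q) P ∧
        (∫ ω, |CovariateShift.quantityOfInterest μX μΘ f φ -
          CovariateShift.qiEstimator (k m) (fun j : Fin m => X' j ω)
            (fun j : Fin m => φ (f (X' j ω, Θ j ω))) (fun i : Fin n => X i ω)| ^ q ∂P) ^ (1 / q) ≤
          C * (1 / √(n : ℝ) + τ n) + C * ((k m : ℝ) / m) ^ (1 / (d : ℝ))) ∧
    -- among the allowed sequences, `k_m = 1` is allowed and minimizes the rate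
    (CovariateShift.IsNeighborSequence fun _ => 1) ∧
    (∀ k : ℕ → ℕ, CovariateShift.IsNeighborSequence k → ∀ m : ℕ, 1 ≤ m →
      ((1 : ℝ) / m) ^ (1 / (d : ℝ)) ≤ ((k m : ℝ) / m) ^ (1 / (d : ℝ))) := by
  classical
  have hq0 : 0 < q := by linarith
  have hd0 : (0 : ℝ) < d := by exact_mod_cast hd_pos
  obtain ⟨θ₀⟩ := nonempty_of_isProbabilityMeasure μΘ
  obtain ⟨L, hL⟩ := hLip
  set g : E → ℝ := fun x => φ (f (x, θ₀)) with hg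
  have hgL : LipschitzWith L g := hL θ₀
  have hfg : ∀ x θ, φ (f (x, θ)) = g x := fun x θ => by rw [hg, hnoiseless x θ θ₀]
  have : ProperSpace E := FiniteDimensional.proper ℝ E
  obtain ⟨κ, r₀, hκ, -, hr₀, hmass₀⟩ := hsupp.minimal_mass
  have hV : 0 < lam.real (Metric.closedBall (0 : E) 1) :=
    ENNReal.toReal_pos (Metric.measure_closedBall_pos lam 0 one_pos).ne'
      measure_closedBall_lt_top.ne
  have hc : 0 < κ * lam.real (Metric.closedBall (0 : E) 1) := mul_pos hκ hV
  have hmass : ∀ x ∈ U, ∀ r : ℝ, 0 ≤ r → r ≤ r₀ →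
      κ * lam.real (Metric.closedBall (0 : E) 1) * p x * r ^ d ≤
        μX'.real (Metric.closedBall x r) := fun x hx r h0 h1 => by
    have := hmass₀ x hx r h0 h1
    rwa [mul_right_comm κ]
  have hU : ∀ᵐ x ∂μX, x ∈ U :=
    Filter.mem_of_superset Measure.support_mem_ae hsupp.support_subset
  have hid := CovariateShift.memLp_id_of_momentCondition hq0 hc hr₀ hsupp.pos hmass hU hmom
  have hgq := CovariateShift.memLp_of_lipschitzWith hid hgL
  have hgi : Integrable g μX := hgq.integrable (by rw [ENNReal.one_le_ofReal]; linarith)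
  have hfz : (fun z : E × T => φ (f z)) = fun z => g z.1 := by
    ext ⟨x, θ⟩; exact hfg x θ
  have hQI : CovariateShift.quantityOfInterest μX μΘ f φ = ∫ x, g x ∂μX := by
    rw [CovariateShift.quantityOfInterest, hfz, integral_fun_fst]
    simp
  refine ⟨?_, ?_, ?_, ?_⟩
  · rw [hfz]
    exact hgi.comp_fst μΘ
  · intro k hk
    have hindX' : iIndepFun X' P :=
      hsample.indep_train.comp (fun _ z => z.1) fun _ => measurable_fst
    obtain ⟨A, hA, hMC⟩ := CovariateShift.exists_integral_abs_sub_average_rpow_le P μX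
      hsample.measurable_eval hsample.law_eval hsample.indep_eval hq hgL.continuous.measurable hgq
    obtain ⟨C, M, hC, hNN⟩ :=
      CovariateShift.exists_lintegral_norm_sub_nearestNeighbor_rpow_le P μX'
        hsample.measurable_train hsample.law_train hindX' hmin hq0 hd_pos hc hr₀ hsupp.pos hmass
    set B := ∫ x, (1 + ‖x‖ ^ q) / p x ^ (q / d) ∂μX with hB
    have hh0 : ∀ᵐ x ∂μX, 0 ≤ (1 + ‖x‖ ^ q) / p x ^ (q / d) := hU.mono fun x hx => by
      have := hsupp.pos x hx
      positivity
    have hB0 : 0 ≤ B := integral_nonneg_of_ae hh0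
    set C₁ := 2 * √A with hC₁
    set C₂ := 2 * (L * (C * B) ^ (1 / q)) with hC₂
    have hC₁0 : 0 ≤ C₁ := by positivity
    have hC₂0 : 0 ≤ C₂ := by positivity
    refine ⟨C₁ + C₂, ?_⟩
    -- This ensures `2 * k m ≤ m`, the range of ranks in which the far tail is controlled.
    have hk2 : ∀ᶠ m : ℕ in atTop, (k m : ℝ) / m < 1 / 2 :=
      hk.tendsto.eventually_lt_const (by norm_num)
    filter_upwards [hk2, eventually_ge_atTop 1, tendsto_natCast_atTop_atTop.eventually_ge_atTop M]
      with m hm2 hm1 hmM n hn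
    have hm0 : (0 : ℝ) < m := by exact_mod_cast hm1
    have hn0 : (0 : ℝ) < n := by exact_mod_cast hn
    have hk1 := hk.pos m hm1
    have h2k : 2 * k m ≤ m := by
      rw [div_lt_iff₀ hm0] at hm2
      have : (2 : ℝ) * k m ≤ m := by linarith
      exact_mod_cast this
    obtain ⟨l, hl⟩ : ∃ l : Fin m, l.val + 1 = k m := ⟨⟨k m - 1, by omega⟩, by simp; omega⟩
    set ρ := (k m : ℝ) / m with hρ
    have hρ0 : 0 ≤ ρ := by positivity
    have hdist : ∀ i, ∫⁻ ω, ENNReal.ofReal (‖X i ω -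
        CovariateShift.nearestNeighbor (fun j : Fin m => X' j ω) l (X i ω)‖ ^ q) ∂P ≤
        ENNReal.ofReal (C * ρ ^ (q / d) * B) := by
      intro i
      have hind : IndepFun (fun ω (j : Fin m) => X' j ω) (X i) P :=
        hsample.indep_train_eval.comp (φ := fun z (j : Fin m) => (z j).1) (ψ := fun z => z i)
          (measurable_pi_lambda _ fun j => (measurable_pi_apply _).fst) (measurable_pi_apply i)
      rw [CovariateShift.lintegral_norm_sub_nearestNeighbor_rpow_eq P hsample.measurable_train
        (hsample.measurable_eval i) hind, hsample.law_eval, hB, ← integral_const_mul,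
        ofReal_integral_eq_lintegral_ofReal (Integrable.const_mul hmom _)
          (hh0.mono fun x hx => mul_nonneg (by positivity) hx)]
      refine lintegral_mono_ae (hU.mono fun x hx => ?_)
      have := hNN m hmM l (by omega) x hx
      rwa [hl] at this
    obtain ⟨hi1, hi2⟩ := hMC n hn
    have hmain := CovariateShift.integrable_and_integral_abs_sub_qiEstimator_rpow_le P hn l
      (x' := fun j => X' j) (fun j => hsample.measurable_train j) (x := fun i => X i)
      (fun i => hsample.measurable_eval i) hgL (by linarith) (∫ x, g x ∂μX) hi1 hi2
      (by positivity) fun i => hdist i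
    simp only [hl] at hmain
    simp only [hfg, hQI]
    refine ⟨hmain.1, ?_⟩
    have e1 : ((A / n) ^ (q / 2)) ^ (1 / q) = √A * (1 / √(n : ℝ)) := by
      rw [← Real.rpow_mul (by positivity), show q / 2 * (1 / q) = 1 / 2 by field_simp,
        ← Real.sqrt_eq_rpow, Real.sqrt_div hA]
      ring
    have e2 : ((L : ℝ) ^ q * (C * ρ ^ (q / d) * B)) ^ (1 / q) =
        L * (C * B) ^ (1 / q) * ρ ^ (1 / (d : ℝ)) := by
      rw [show (L : ℝ) ^ q * (C * ρ ^ (q / d) * B) = (L : ℝ) ^ q * ((C * B) * ρ ^ (q / d)) by ring,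
        Real.mul_rpow (by positivity) (by positivity),
        Real.mul_rpow (by positivity) (by positivity), ← Real.rpow_mul L.coe_nonneg, ← Real.rpow_mul hρ0,
        mul_one_div_cancel hq0.ne', Real.rpow_one,
        show q / d * (1 / q) = 1 / (d : ℝ) by field_simp]
      ring
    have e3 : ((2 : ℝ) ^ q) ^ (1 / q) = 2 := by
      rw [← Real.rpow_mul (by norm_num), mul_one_div_cancel hq0.ne', Real.rpow_one]
    have hx : 0 ≤ 1 / √(n : ℝ) := by positivity
    have hy : 0 ≤ ρ ^ (1 / (d : ℝ)) := by positivity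
    have hτ0 : (0 : ℝ) ≤ τ n := (τ n).2
    calc _ ≤ (2 ^ q * ((A / n) ^ (q / 2) + (L : ℝ) ^ q * (C * ρ ^ (q / d) * B))) ^ (1 / q) :=
          Real.rpow_le_rpow (integral_nonneg fun ω => by positivity) hmain.2 (by positivity)
      _ = 2 * ((A / n) ^ (q / 2) + (L : ℝ) ^ q * (C * ρ ^ (q / d) * B)) ^ (1 / q) := by
          rw [Real.mul_rpow (by positivity) (by positivity), e3]
      -- Subadditivity of the power `1 / q ≤ 1` separates the two errors.
      _ ≤ 2 * (((A / n) ^ (q / 2)) ^ (1 / q) +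
            ((L : ℝ) ^ q * (C * ρ ^ (q / d) * B)) ^ (1 / q)) :=
          mul_le_mul_of_nonneg_left (Real.rpow_add_le_add_rpow (by positivity) (by positivity)
            (by positivity) ((div_le_one hq0).2 (by linarith))) (by norm_num)
      _ = C₁ * (1 / √(n : ℝ)) + C₂ * ρ ^ (1 / (d : ℝ)) := by
          rw [e1, e2, hC₁, hC₂]; ring
      _ ≤ _ := by
          refine add_le_add ?_ ?_
          · exact mul_le_mul (le_add_of_nonneg_right hC₂0) (le_add_of_nonneg_right hτ0) hx
              (by positivity)
          · exact mul_le_mul_of_nonneg_right (le_add_of_nonneg_left hC₁0) hy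
  · exact ⟨fun _ _ => le_rfl, fun _ _ _ _ _ => le_rfl, by
      simpa using tendsto_one_div_atTop_nhds_zero_nat (𝕜 := ℝ)⟩
  · intro k hk m hm
    have h1 : (1 : ℝ) ≤ k m := by exact_mod_cast hk.pos m hm
    exact Real.rpow_le_rpow (by positivity) (by gcongr) (by positivity)
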